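/- Let $(M,g)$ be a smooth $n$-dimensional Riemannian manifold, let $Y\subseteq TM$ be a smooth involutive sub-bundle of rank $s$, let $X=Y^{\perp}$, of rank $r=n-s$, and for a constant $f>0$ let $g'=g_X\oplus\frac1{f^2}g_Y$, with scalar curvature $S$. An adapted orthonormal frame on an open set $U$ is a smooth $g$-orthonormal frame $e_1,\dots,e_n$ of $TM|_U$ such that $e_1,\dots,e_r$ span $X$ and $e_{r+1},\dots,e_n$ span $Y$; its structure functions are given by $[e_A,e_B]=\sum_C c^C_{AB}e_C$. Roman indices run over $1,\dots,r$, Greek indices over $r+1,\dots,n$, and repeated indices are summed. Put $\Gamma^C_{AB}=\frac12(c^C_{AB}-c^A_{BC}+c^B_{CA})$ and $$S_D=\sum_{j,k\in D}\Big(e_k(\Gamma^k_{jj})-e_j(\Gamma^k_{kj})+\sum_{l\in D}\big(\Gamma^k_{kl}\Gamma^l_{jj}-\Gamma^k_{jl}\Gamma^l_{kj}-c^l_{kj}\Gamma^k_{lj}\big)\Big).$$ Let $S_1$, $S_2$ (the scalar curvatures restricted to $X$ and to $Y$) be $S_D$ with $D$ the set of Roman, respectively of Greek, indices. (1) For every adapted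 orthonormal frame on an open set $U$, at every point of $U$ and for every $f>0$, one has $-\frac14 c^i_{\gamma\beta}c^i_{\gamma\beta}=0$ and $$\begin{aligned}S={}&S_1+f^2S_2\\&+\Big(2e_{\gamma}(c^j_{\gamma j})-c^k_{\alpha k}c^j_{\alpha j}-2c^k_{\alpha k}c^{\beta}_{\alpha\beta}-\tfrac12c^k_{i\beta}c^i_{k\beta}-c^i_{\gamma\beta}c^{\gamma}_{i\beta}-\tfrac12c^i_{\gamma j}c^i_{\gamma j}\Big)f^2\\&+\Big(2e_k(c^{\beta}_{k\beta})-c^{\gamma}_{i\gamma}c^{\beta}_{i\beta}-2c^{\gamma}_{i\gamma}c^j_{ij}-\tfrac12c^{\alpha}_{\gamma j}c^{\gamma}_{\alpha j}-c^i_{\gamma j}c^{\gamma}_{ij}-\tfrac12c^{\alpha}_{k\beta}c^{\alpha}_{k\beta}\Big)\\&-\frac1{4f^2}c^{\alpha}_{kj}c^{\alpha}_{kj}.\end{aligned}$$ (2) Suppose moreover that $g$ is nearly positively bundle-like with respect to $Y$, i.e. around every point of $M$ there is an adapted orthonormal frame on an open neighbourhood $U$ on which $$S_2+2e_{\gamma}(c^j_{\gamma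 j})-c^k_{\alpha k}c^j_{\alpha j}-2c^k_{\alpha k}c^{\beta}_{\alpha\beta}-\tfrac12c^k_{i\beta}c^i_{k\beta}-\tfrac12c^i_{\gamma j}c^i_{\gamma j}>0 .$$ Then for every compact $K\subseteq M$ there is $f_0>0$ such that $S>0$ on $K$ for all constants $f\ge f_0$. In particular, if $M$ is compact, then for all sufficiently large constants $f$ the smooth Riemannian metric $g'=g_X\oplus\frac1{f^2}g_Y$ has positive scalar curvature on all of $M$. -/

import Mathlib

open Bundle Manifold
open scoped ContDiff Matrix

noncomputable section

namespace Collapse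

/-! ### Scalar curvature of a metric given in coordinates -/

section Coordinates

variable {n : ℕ}

/-- The partial derivative `∂ₖ F` at `y` of a function on `ℝⁿ`. -/
def partialDeriv (k : Fin n) (F : EuclideanSpace ℝ (Fin n) → ℝ)
    (y : EuclideanSpace ℝ (Fin n)) : ℝ :=
  fderiv ℝ F y (EuclideanSpace.single k 1)

/-- The Christoffel symbol `Γᵏᵢⱼ = ½ gᵏˡ (∂ᵢ gⱼₗ + ∂ⱼ gᵢₗ - ∂ₗ gᵢⱼ)` of the metric coefficients
`G`. -/
def christoffel (G : EuclideanSpace ℝ (Fin n) → Matrix (Fin n) (Fin n) ℝ) (k i j : Fin n)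
    (y : EuclideanSpace ℝ (Fin n)) : ℝ :=
  (1 / 2) * ∑ l, (G y)⁻¹ k l *
    (partialDeriv i (fun z => G z j l) y + partialDeriv j (fun z => G z i l) y
      - partialDeriv l (fun z => G z i j) y)

/-- The component `Rˡₖᵢⱼ` of the curvature tensor, where `R(∂ᵢ, ∂ⱼ)∂ₖ = Rˡₖᵢⱼ ∂ₗ` and
`R(U, V) = ∇_U ∇_V - ∇_V ∇_U - ∇_[U, V]`. -/
def riemann (G : EuclideanSpace ℝ (Fin n) → Matrix (Fin n) (Fin n) ℝ) (l k i j : Fin n)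
    (y : EuclideanSpace ℝ (Fin n)) : ℝ :=
  partialDeriv i (christoffel G l j k) y - partialDeriv j (christoffel G l i k) y
    + ∑ m, (christoffel G l i m y * christoffel G m j k y
      - christoffel G l j m y * christoffel G m i k y)

/-- The Ricci tensor `Ricⱼₖ = Rⁱₖᵢⱼ`. -/
def ricci (G : EuclideanSpace ℝ (Fin n) → Matrix (Fin n) (Fin n) ℝ) (j k : Fin n)
    (y : EuclideanSpace ℝ (Fin n)) : ℝ :=
  ∑ i, riemann G i k i j y

/-- The scalar curvature `gʲᵏ Ricⱼₖ` (positive for round spheres). -/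
def coordScalarCurvature (G : EuclideanSpace ℝ (Fin n) → Matrix (Fin n) (Fin n) ℝ)
    (y : EuclideanSpace ℝ (Fin n)) : ℝ :=
  ∑ j, ∑ k, (G y)⁻¹ j k * ricci G j k y

end Coordinates

section Manifold

variable {n r s : ℕ} {M : Type*} [TopologicalSpace M] [ChartedSpace (EuclideanSpace ℝ (Fin n)) M]

/-- The coefficients `h(∂ᵢ, ∂ⱼ)`, in the preferred chart at `p`, of a field of bilinear forms `h`
on the tangent spaces. -/
def gramInChart (h : ∀ x : M, TangentSpace (𝓡 n) x →L[ℝ] TangentSpace (𝓡 n) x →L[ℝ] ℝ) (p : M)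
    (y : EuclideanSpace ℝ (Fin n)) : Matrix (Fin n) (Fin n) ℝ :=
  Matrix.of fun i j =>
    h ((extChartAt (𝓡 n) p).symm y)
      (mfderiv (𝓡 n) (𝓡 n) (extChartAt (𝓡 n) p).symm y (EuclideanSpace.single i (1 : ℝ)))
      (mfderiv (𝓡 n) (𝓡 n) (extChartAt (𝓡 n) p).symm y (EuclideanSpace.single j (1 : ℝ)))

/-- The scalar curvature at `p` of the metric `h`, computed in the preferred chart at `p`. -/
def scalarCurvature (h : ∀ x : M, TangentSpace (𝓡 n) x →L[ℝ] TangentSpace (𝓡 n) x →L[ℝ] ℝ)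
    (p : M) : ℝ :=
  coordScalarCurvature (gramInChart h p) (extChartAt (𝓡 n) p p)

/-- `h` is a smooth Riemannian metric with positive scalar curvature. -/
def IsPSCMetric [IsManifold (𝓡 n) ∞ M]
    (h : ∀ x : M, TangentSpace (𝓡 n) x →L[ℝ] TangentSpace (𝓡 n) x →L[ℝ] ℝ) : Prop :=
  (∃ g' : ContMDiffRiemannianMetric (𝓡 n) ∞ (EuclideanSpace ℝ (Fin n))
      (fun x : M => TangentSpace (𝓡 n) x), ∀ x, g'.inner x = h x) ∧
    ∀ x, 0 < scalarCurvature h x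

/-- The vector field `V` is smooth on `U`. -/
def SmoothFieldOn (V : ∀ x : M, TangentSpace (𝓡 n) x) (U : Set M) [IsManifold (𝓡 n) ∞ M] : Prop :=
  ContMDiffOn (𝓡 n) (𝓡 n).tangent ∞ (fun x => (⟨x, V x⟩ : TangentBundle (𝓡 n) M)) U

/-- `Y` is a smooth sub-bundle of rank `s` of the tangent bundle: around every point it has a
smooth local frame consisting of `s` vector fields. -/
def IsSubbundle [IsManifold (𝓡 n) ∞ M] (s : ℕ)
    (Y : ∀ x : M, Submodule ℝ (TangentSpace (𝓡 n) x)) : Prop :=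
  ∀ p : M, ∃ U : Set M, IsOpen U ∧ p ∈ U ∧ ∃ V : Fin s → ∀ x : M, TangentSpace (𝓡 n) x,
    (∀ a, SmoothFieldOn (V a) U) ∧
      ∀ x ∈ U, LinearIndependent ℝ (fun a => V a x) ∧
        Submodule.span ℝ (Set.range fun a => V a x) = Y x

/-- `Y` is involutive: the bracket of two local sections of `Y` is a section of `Y`. -/
def IsInvolutive [IsManifold (𝓡 n) ∞ M]
    (Y : ∀ x : M, Submodule ℝ (TangentSpace (𝓡 n) x)) : Prop :=
  ∀ (U : Set M) (V W : ∀ x : M, TangentSpace (𝓡 n) x), IsOpen U →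
    SmoothFieldOn V U → SmoothFieldOn W U → (∀ x ∈ U, V x ∈ Y x) → (∀ x ∈ U, W x ∈ Y x) →
      ∀ x ∈ U, VectorField.mlieBracket (𝓡 n) V W x ∈ Y x

/-- The derivative `V(F)` of the function `F` along the vector field `V`. -/
def dirDeriv (V : ∀ x : M, TangentSpace (𝓡 n) x) (F : M → ℝ) (x : M) : ℝ :=
  mfderiv (𝓡 n) 𝓘(ℝ, ℝ) F x (V x)

variable [RiemannianBundle (fun x : M => TangentSpace (𝓡 n) x)]

instance finiteDimensionalTangent (x : M) : FiniteDimensional ℝ (TangentSpace (𝓡 n) x) :=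
  inferInstanceAs (FiniteDimensional ℝ (EuclideanSpace ℝ (Fin n)))

/-- The form `g_X ⊕ f⁻² g_Y`, where `g` is the Riemannian metric of `M` and `X` is the orthogonal
complement of `Y`. -/
def collapsedMetric (Y : ∀ x : M, Submodule ℝ (TangentSpace (𝓡 n) x)) (f : ℝ) (x : M) :
    TangentSpace (𝓡 n) x →L[ℝ] TangentSpace (𝓡 n) x →L[ℝ] ℝ :=
  (innerSL ℝ).bilinearComp (Y x)ᗮ.starProjection (Y x)ᗮ.starProjection
    + (f ^ 2)⁻¹ • (innerSL ℝ).bilinearComp (Y x).starProjection (Y x).starProjection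

/-- `e` is an adapted orthonormal frame on the open set `U`: the vector fields `e (inl i)` (Roman
indices) are sections of `X = Yᗮ`, the vector fields `e (inr α)` (Greek indices) are sections
of `Y`, and together they form a smooth orthonormal frame of the tangent bundle. -/
structure IsAdaptedFrame [IsManifold (𝓡 n) ∞ M]
    (Y : ∀ x : M, Submodule ℝ (TangentSpace (𝓡 n) x)) (U : Set M)
    (e : Fin r ⊕ Fin s → ∀ x : M, TangentSpace (𝓡 n) x) : Prop where
  isOpen : IsOpen U
  smooth : ∀ A, SmoothFieldOn (e A) U
  orthonormal : ∀ x ∈ U, Orthonormal ℝ (fun A => e A x)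
  span_X : ∀ x ∈ U, Submodule.span ℝ (Set.range fun i => e (Sum.inl i) x) = (Y x)ᗮ
  span_Y : ∀ x ∈ U, Submodule.span ℝ (Set.range fun α => e (Sum.inr α) x) = Y x

/-- `structureFn e C A B` is the structure function `c^C_{AB}` of the orthonormal frame `e`, i.e.
the coefficient of `e_C` in `[e_A, e_B] = ∑_C c^C_{AB} e_C`. -/
def structureFn {ι : Type*} (e : ι → ∀ x : M, TangentSpace (𝓡 n) x) (C A B : ι) (x : M) : ℝ :=
  inner ℝ (VectorField.mlieBracket (𝓡 n) (e A) (e B) x) (e C x)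

/-- The connection coefficient `Γ^C_{AB} = ½ (c^C_{AB} - c^A_{BC} + c^B_{CA})` of the Levi-Civita
connection in the orthonormal frame `e`, i.e. `⟨∇_{e_A} e_B, e_C⟩`. -/
def connCoeff {ι : Type*} (e : ι → ∀ x : M, TangentSpace (𝓡 n) x) (C A B : ι) (x : M) : ℝ :=
  (1 / 2) * (structureFn e C A B x - structureFn e A B C x + structureFn e B C A x)

/-- The scalar curvature of `M` restricted to the sub-bundle `D` spanned by the orthonormal family
`e`. It is `∑_{j,k} Ω^k_j(e_k, e_j)` with `Ω = dω + ω ∧ ω`, where `ω^k_j = ∑_i Γ^k_{ij} e^i` are the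
connection forms along `D`, so that
`Ω^k_j(e_k, e_j) = e_k(Γ^k_{jj}) - e_j(Γ^k_{kj}) - c^l_{kj} Γ^k_{lj}
+ Γ^k_{kl} Γ^l_{jj} - Γ^k_{jl} Γ^l_{kj}`, with all indices in `D`.
If `D` is involutive, this is the scalar curvature of the leaves with the induced metric. -/
def blockScalarCurvature {ι : Type*} [Fintype ι] (e : ι → ∀ x : M, TangentSpace (𝓡 n) x)
    (x : M) : ℝ :=
  ∑ j, ∑ k, (dirDeriv (e k) (connCoeff e k j j) x - dirDeriv (e j) (connCoeff e k k j) x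
    + ∑ l, (connCoeff e k k l x * connCoeff e l j j x - connCoeff e k j l x * connCoeff e l k j x
      - structureFn e l k j x * connCoeff e k l j x))

variable (e : Fin r ⊕ Fin s → ∀ x : M, TangentSpace (𝓡 n) x)

/-- `S₁`, the scalar curvature of `M` restricted to `X`. -/
def scalarX (x : M) : ℝ := blockScalarCurvature (fun i => e (Sum.inl i)) x

/-- `S₂`, the scalar curvature of `M` restricted to `Y`. -/
def scalarY (x : M) : ℝ := blockScalarCurvature (fun α => e (Sum.inr α)) x

open Sum in
/-- The coefficient of `f⁴`: `-¼ c^i_{γβ} c^i_{γβ}`. -/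
def quarticTerm (x : M) : ℝ :=
  let c := (fun C A B => structureFn e C A B x);
  -(1 / 4) * ∑ i, ∑ γ, ∑ β, c (inl i) (inr γ) (inr β) * c (inl i) (inr γ) (inr β)

open Sum in
/-- The terms with factor `f²` that involve mixed indices:
`2e_γ(c^j_{γj}) - c^k_{αk}c^j_{αj} - 2c^k_{αk}c^β_{αβ} - ½c^k_{iβ}c^i_{kβ} - c^i_{γβ}c^γ_{iβ}
- ½c^i_{γj}c^i_{γj}`. -/
def quadraticTerm (x : M) : ℝ :=
  let c := (fun C A B => structureFn e C A B x);
  2 * (∑ γ, ∑ j, dirDeriv (e (inr γ)) (structureFn e (inl j) (inr γ) (inl j)) x)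
    - (∑ α, ∑ k, ∑ j, c (inl k) (inr α) (inl k) * c (inl j) (inr α) (inl j))
    - 2 * (∑ α, ∑ k, ∑ β, c (inl k) (inr α) (inl k) * c (inr β) (inr α) (inr β))
    - (1 / 2) * (∑ i, ∑ k, ∑ β, c (inl k) (inl i) (inr β) * c (inl i) (inl k) (inr β))
    - (∑ i, ∑ γ, ∑ β, c (inl i) (inr γ) (inr β) * c (inr γ) (inl i) (inr β))
    - (1 / 2) * (∑ i, ∑ γ, ∑ j, c (inl i) (inr γ) (inl j) * c (inl i) (inr γ) (inl j))

open Sum in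
/-- The terms with factor `f⁰` that involve mixed indices:
`2e_k(c^β_{kβ}) - c^γ_{iγ}c^β_{iβ} - 2c^γ_{iγ}c^j_{ij} - ½c^α_{γj}c^γ_{αj} - c^i_{γj}c^γ_{ij}
- ½c^α_{kβ}c^α_{kβ}`. -/
def constantTerm (x : M) : ℝ :=
  let c := (fun C A B => structureFn e C A B x);
  2 * (∑ k, ∑ β, dirDeriv (e (inl k)) (structureFn e (inr β) (inl k) (inr β)) x)
    - (∑ i, ∑ γ, ∑ β, c (inr γ) (inl i) (inr γ) * c (inr β) (inl i) (inr β))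
    - 2 * (∑ i, ∑ γ, ∑ j, c (inr γ) (inl i) (inr γ) * c (inl j) (inl i) (inl j))
    - (1 / 2) * (∑ α, ∑ γ, ∑ j, c (inr α) (inr γ) (inl j) * c (inr γ) (inr α) (inl j))
    - (∑ i, ∑ γ, ∑ j, c (inl i) (inr γ) (inl j) * c (inr γ) (inl i) (inl j))
    - (1 / 2) * (∑ α, ∑ k, ∑ β, c (inr α) (inl k) (inr β) * c (inr α) (inl k) (inr β))

open Sum in
/-- The coefficient of `f⁻²`: `-¼ c^α_{kj} c^α_{kj}`. -/
def inverseQuadraticTerm (x : M) : ℝ :=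
  let c := (fun C A B => structureFn e C A B x);
  -(1 / 4) * ∑ α, ∑ k, ∑ j, c (inr α) (inl k) (inl j) * c (inr α) (inl k) (inl j)

open Sum in
/-- The combination
`S₂ + 2e_γ(c^j_{γj}) - c^k_{αk}c^j_{αj} - 2c^k_{αk}c^β_{αβ} - ½c^k_{iβ}c^i_{kβ}
- ½c^i_{γj}c^i_{γj}`. -/
def npbExpr (x : M) : ℝ :=
  let c := (fun C A B => structureFn e C A B x);
  scalarY e x
    + 2 * (∑ γ, ∑ j, dirDeriv (e (inr γ)) (structureFn e (inl j) (inr γ) (inl j)) x)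
    - (∑ α, ∑ k, ∑ j, c (inl k) (inr α) (inl k) * c (inl j) (inr α) (inl j))
    - 2 * (∑ α, ∑ k, ∑ β, c (inl k) (inr α) (inl k) * c (inr β) (inr α) (inr β))
    - (1 / 2) * (∑ i, ∑ k, ∑ β, c (inl k) (inl i) (inr β) * c (inl i) (inl k) (inr β))
    - (1 / 2) * (∑ i, ∑ γ, ∑ j, c (inl i) (inr γ) (inl j) * c (inl i) (inr γ) (inl j))

/-- The metric of `M` is nearly positively bundle-like with respect to `Y`, a sub-bundle of
rank `s` with orthogonal complement of rank `r`. -/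
def IsNPB [IsManifold (𝓡 n) ∞ M] (r s : ℕ)
    (Y : ∀ x : M, Submodule ℝ (TangentSpace (𝓡 n) x)) : Prop :=
  ∀ p : M, ∃ (U : Set M) (e : Fin r ⊕ Fin s → ∀ x : M, TangentSpace (𝓡 n) x),
    p ∈ U ∧ IsAdaptedFrame Y U e ∧ ∀ x ∈ U, 0 < npbExpr e x

end Manifold

end Collapse

end

/-! The metric `g'` is studied through a rescaled frame. If the Greek vectors of an adapted frame
are multiplied by `f` and the Roman ones are kept, the result is `g'`-orthonormal. With weights `λ_A
∈ {1, f}`, its structure functions are `λ_A λ_B / λ_C * c^C_{AB}`, because `f` is constant. It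
remains to know the scalar curvature of a metric in terms of the structure functions of an
orthonormal frame.

That formula is `S = 2 e_A(c^B_{AB}) - c^B_{AB} c^C_{AC} - ½ c^C_{AB} c^B_{AC} - ¼ c^C_{AB}
c^C_{AB}` (`IsCoordFrame.coordScalarCurvature_eq`). It comes from Cartan's method in a chart. The
Levi-Civita connection, written in the frame, is torsion-free and skew, so Koszul's formula
expresses it by the `c`'s (`frameConn_eq`). Symmetry of second derivatives shows that its curvature
form is the conjugated Riemann tensor (`riemannMatrix_mul`). The contraction of the curvature form
then gives the formula.

Under rescaling, the derivative, trace and Killing-type terms acquire `λ_A²`, and the sum of squares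
acquires `(λ_A λ_B / λ_C)²`. Splitting the sums into Roman and Greek blocks gives the powers of `f`
(`frame_formula_scaled`). The pure blocks are `S₁` and `f² S₂`, since the same formula holds for
`blockScalarCurvature` as an algebraic identity. The `f⁴` coefficient involves only `c^i_{γβ}`,
which vanishes by involutivity.

For the same reason the whole `f²` coefficient equals `npbExpr`. If this is positive at a point it
dominates near that point for large `f`, and compactness makes the threshold uniform. Smoothness and
positivity of `g'` are read off from its diagonal form in an adapted frame. -/

noncomputable section

namespace Collapse

/-! ### Partial derivatives and smoothness of matrix inverses on `ℝⁿ`. -/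

section CoordinateFrames

open scoped Topology

variable {n : ℕ} {ι : Type*}

/-- The frame `E` on the open subset `V` of `ℝⁿ` is smooth, orthonormal for the metric with
coefficients `G`, and has the structure functions `c`. -/
structure IsCoordFrame [Fintype ι] [DecidableEq ι] (V : Set (EuclideanSpace ℝ (Fin n)))
    (G : EuclideanSpace ℝ (Fin n) → Matrix (Fin n) (Fin n) ℝ)
    (E : ι → EuclideanSpace ℝ (Fin n) → EuclideanSpace ℝ (Fin n))
    (c : ι → ι → ι → EuclideanSpace ℝ (Fin n) → ℝ) : Prop where
  isOpen : IsOpen V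
  card : Fintype.card ι = n
  smooth : ∀ A, ContDiffOn ℝ ∞ (E A) V
  orthonormal : ∀ y ∈ V, ∀ A B,
    ∑ i, ∑ j, E A y i * G y i j * E B y j = if A = B then 1 else 0
  bracket : ∀ y ∈ V, ∀ A B,
    VectorField.lieBracket ℝ (E A) (E B) y = ∑ C, c C A B y • E C y
  antisymm : ∀ C A B y, c C A B y = -c C B A y

theorem partialDeriv_contDiffOn {V : Set (EuclideanSpace ℝ (Fin n))} (hV : IsOpen V)
    {F : EuclideanSpace ℝ (Fin n) → ℝ} (hF : ContDiffOn ℝ ∞ F V) (k : Fin n) :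
    ContDiffOn ℝ ∞ (partialDeriv k F) V :=
  (hF.fderiv_of_isOpen hV (m := ∞) (by simp)).clm_apply contDiffOn_const

theorem differentiableAt_of_contDiffOn {V : Set (EuclideanSpace ℝ (Fin n))} (hV : IsOpen V)
    {F : EuclideanSpace ℝ (Fin n) → ℝ} (hF : ContDiffOn ℝ ∞ F V)
    {y : EuclideanSpace ℝ (Fin n)} (hy : y ∈ V) : DifferentiableAt ℝ F y :=
  (hF.differentiableOn (by simp) y hy).differentiableAt (hV.mem_nhds hy)

theorem partialDeriv_congr {V : Set (EuclideanSpace ℝ (Fin n))} (hV : IsOpen V)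
    {F F' : EuclideanSpace ℝ (Fin n) → ℝ} (h : ∀ z ∈ V, F z = F' z)
    {y : EuclideanSpace ℝ (Fin n)} (hy : y ∈ V) (k : Fin n) :
    partialDeriv k F y = partialDeriv k F' y := by
  have : F =ᶠ[𝓝 y] F' := Filter.eventuallyEq_of_mem (hV.mem_nhds hy) h
  simp [partialDeriv, this.fderiv_eq]

theorem partialDeriv_mul {F F' : EuclideanSpace ℝ (Fin n) → ℝ} {y : EuclideanSpace ℝ (Fin n)}
    (hF : DifferentiableAt ℝ F y) (hF' : DifferentiableAt ℝ F' y) (k : Fin n) :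
    partialDeriv k (fun z => F z * F' z) y
      = partialDeriv k F y * F' y + F y * partialDeriv k F' y := by
  simp only [partialDeriv]
  rw [fderiv_fun_mul hF hF']
  simp; ring

theorem partialDeriv_sub {F F' : EuclideanSpace ℝ (Fin n) → ℝ} {y : EuclideanSpace ℝ (Fin n)}
    (hF : DifferentiableAt ℝ F y) (hF' : DifferentiableAt ℝ F' y) (k : Fin n) :
    partialDeriv k (fun z => F z - F' z) y = partialDeriv k F y - partialDeriv k F' y := by
  simp only [partialDeriv]
  rw [fderiv_fun_sub hF hF']
  simp

theorem partialDeriv_sum {κ : Type*} [Fintype κ] {F : κ → EuclideanSpace ℝ (Fin n) → ℝ}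
    {y : EuclideanSpace ℝ (Fin n)} (hF : ∀ a, DifferentiableAt ℝ (F a) y) (k : Fin n) :
    partialDeriv k (fun z => ∑ a, F a z) y = ∑ a, partialDeriv k (F a) y := by
  simp only [partialDeriv]
  rw [fderiv_fun_sum fun a _ => hF a]
  simp

theorem partialDeriv_comm {V : Set (EuclideanSpace ℝ (Fin n))} (hV : IsOpen V)
    {F : EuclideanSpace ℝ (Fin n) → ℝ} (hF : ContDiffOn ℝ ∞ F V)
    {y : EuclideanSpace ℝ (Fin n)} (hy : y ∈ V) (i j : Fin n) :
    partialDeriv i (partialDeriv j F) y = partialDeriv j (partialDeriv i F) y := by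
  have h1 : ContDiffAt ℝ ∞ F y := hF.contDiffAt (hV.mem_nhds hy)
  have h2 : IsSymmSndFDerivAt ℝ F y := h1.isSymmSndFDerivAt (by simpa using ENat.LEInfty.out)
  have h3 : DifferentiableAt ℝ (fderiv ℝ F) y :=
    ((hF.fderiv_of_isOpen hV (m := ∞) (by simp)).differentiableOn (by simp) y hy).differentiableAt
      (hV.mem_nhds hy)
  have key : ∀ v w, fderiv ℝ (fun z => fderiv ℝ F z v) y w = fderiv ℝ (fderiv ℝ F) y w v := by
    intro v w
    rw [fderiv_clm_apply h3 (differentiableAt_const v)]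
    simp
  change fderiv ℝ (fun z => fderiv ℝ F z _) y _ = fderiv ℝ (fun z => fderiv ℝ F z _) y _
  rw [key, key]
  exact h2 _ _

theorem fderiv_eq_sum_partialDeriv (F : EuclideanSpace ℝ (Fin n) → ℝ)
    (y v : EuclideanSpace ℝ (Fin n)) : fderiv ℝ F y v = ∑ k, v k * partialDeriv k F y := by
  conv_lhs => rw [← (EuclideanSpace.basisFun (Fin n) ℝ).sum_repr v]
  simp [partialDeriv]

theorem contDiffOn_det {κ : Type*} [Fintype κ] [DecidableEq κ] {V : Set (EuclideanSpace ℝ (Fin n))}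
    {A : EuclideanSpace ℝ (Fin n) → Matrix κ κ ℝ}
    (hA : ∀ i j, ContDiffOn ℝ ∞ (fun y => A y i j) V) :
    ContDiffOn ℝ ∞ (fun y => (A y).det) V := by
  simp only [Matrix.det_apply']
  exact ContDiffOn.sum fun σ _ => contDiffOn_const.mul (contDiffOn_prod fun i _ => hA _ _)

theorem contDiffOn_matrix_inv {κ : Type*} [Fintype κ] [DecidableEq κ]
    {V : Set (EuclideanSpace ℝ (Fin n))} {A : EuclideanSpace ℝ (Fin n) → Matrix κ κ ℝ}
    (hA : ∀ i j, ContDiffOn ℝ ∞ (fun y => A y i j) V) (hdet : ∀ y ∈ V, (A y).det ≠ 0) (i j : κ) :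
    ContDiffOn ℝ ∞ (fun y => (A y)⁻¹ i j) V := by
  simp only [Matrix.inv_def, Matrix.smul_apply, smul_eq_mul, Ring.inverse_eq_inv',
    Matrix.adjugate_apply]
  refine ((contDiffOn_det hA).inv hdet).mul (contDiffOn_det fun k l => ?_)
  -- An adjugate entry is the determinant of `A` with row `j` replaced by a constant unit vector.
  by_cases h : k = j
  · subst h; simpa using contDiffOn_const
  · simpa [Matrix.updateRow_ne h] using hA k l

end CoordinateFrames

/-! ### The Levi-Civita connection in an orthonormal frame over a chart. -/

section CoordinateFrames

open scoped Topology

variable {n : ℕ} {ι : Type*}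

/-- The matrix whose columns are the vectors of the frame `E`. -/
def frameMatrix (E : ι → EuclideanSpace ℝ (Fin n) → EuclideanSpace ℝ (Fin n))
    (y : EuclideanSpace ℝ (Fin n)) : Matrix (Fin n) ι ℝ :=
  Matrix.of fun k A => E A y k

/-- The partial derivative of `frameMatrix E` in the direction `i`. -/
def frameMatrixDeriv (E : ι → EuclideanSpace ℝ (Fin n) → EuclideanSpace ℝ (Fin n)) (i : Fin n)
    (y : EuclideanSpace ℝ (Fin n)) : Matrix (Fin n) ι ℝ :=
  Matrix.of fun k A => partialDeriv i (fun z => E A z k) y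

/-- The matrix `(Γᵏᵢⱼ)ₖⱼ` of the Levi-Civita connection in the direction `i`. -/
def christoffelMatrix (G : EuclideanSpace ℝ (Fin n) → Matrix (Fin n) (Fin n) ℝ) (i : Fin n)
    (y : EuclideanSpace ℝ (Fin n)) : Matrix (Fin n) (Fin n) ℝ :=
  Matrix.of fun k j => christoffel G k i j y

/-- The dual coframe of an orthonormal frame. -/
def coframe (G : EuclideanSpace ℝ (Fin n) → Matrix (Fin n) (Fin n) ℝ)
    (E : ι → EuclideanSpace ℝ (Fin n) → EuclideanSpace ℝ (Fin n))
    (y : EuclideanSpace ℝ (Fin n)) : Matrix ι (Fin n) ℝ :=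
  (frameMatrix E y)ᵀ * G y

/-- The matrix of the connection form of the Levi-Civita connection in the frame `E`, evaluated
at `∂ᵢ`. -/
def connectionMatrix (G : EuclideanSpace ℝ (Fin n) → Matrix (Fin n) (Fin n) ℝ)
    (E : ι → EuclideanSpace ℝ (Fin n) → EuclideanSpace ℝ (Fin n)) (i : Fin n)
    (y : EuclideanSpace ℝ (Fin n)) : Matrix ι ι ℝ :=
  coframe G E y * (frameMatrixDeriv E i y + christoffelMatrix G i y * frameMatrix E y)

namespace IsCoordFrame

variable [Fintype ι] [DecidableEq ι] {V : Set (EuclideanSpace ℝ (Fin n))}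
  {G : EuclideanSpace ℝ (Fin n) → Matrix (Fin n) (Fin n) ℝ}
  {E : ι → EuclideanSpace ℝ (Fin n) → EuclideanSpace ℝ (Fin n)}
  {c : ι → ι → ι → EuclideanSpace ℝ (Fin n) → ℝ} (h : IsCoordFrame V G E c)
  {y : EuclideanSpace ℝ (Fin n)}

include h

theorem coframe_mul (hy : y ∈ V) : coframe G E y * frameMatrix E y = 1 := by
  ext A B
  rw [Matrix.one_apply, ← h.orthonormal y hy A B, Finset.sum_comm]
  simp [coframe, frameMatrix, Matrix.mul_apply, Finset.sum_mul]

theorem mul_coframe (hy : y ∈ V) : frameMatrix E y * coframe G E y = 1 :=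
  (Matrix.mul_eq_one_comm_of_card_eq _ _ _ (by simp [h.card])).1 (h.coframe_mul hy)

/-- Orthonormality reads `Mᵀ G M = 1` with `M` square, so the metric is recovered from the frame
alone. Symmetry and smoothness of `G` are deduced from this and are not part of `IsCoordFrame`. -/
theorem gram_inv (hy : y ∈ V) : (G y)⁻¹ = frameMatrix E y * (frameMatrix E y)ᵀ :=
  Matrix.inv_eq_left_inv (by rw [Matrix.mul_assoc]; exact h.mul_coframe hy)

theorem gram_eq (hy : y ∈ V) : G y = (frameMatrix E y * (frameMatrix E y)ᵀ)⁻¹ :=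
  (Matrix.inv_eq_right_inv (by rw [Matrix.mul_assoc]; exact h.mul_coframe hy)).symm

theorem gram_mul_inv (hy : y ∈ V) : G y * (G y)⁻¹ = 1 := by
  rw [h.gram_inv hy]
  exact mul_eq_one_comm.1 (by rw [Matrix.mul_assoc]; exact h.mul_coframe hy)

theorem gram_symm (hy : y ∈ V) (i j : Fin n) : G y i j = G y j i := by
  have : (G y)ᵀ = G y := by
    rw [h.gram_eq hy, Matrix.transpose_nonsing_inv]; simp
  exact (congrFun (congrFun this j) i)

theorem frameMatrix_contDiffOn (k : Fin n) (A : ι) :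
    ContDiffOn ℝ ∞ (fun z => frameMatrix E z k A) V :=
  contDiffOn_euclidean.1 (h.smooth A) k

theorem gram_contDiffOn (i j : Fin n) : ContDiffOn ℝ ∞ (fun z => G z i j) V := by
  refine (contDiffOn_matrix_inv (A := fun z => frameMatrix E z * (frameMatrix E z)ᵀ)
    (fun k l => ?_) (fun y hy h0 => ?_) i j).congr fun y hy => by rw [h.gram_eq hy]
  · simp only [Matrix.mul_apply, Matrix.transpose_apply]
    exact ContDiffOn.sum fun A _ =>
      (h.frameMatrix_contDiffOn k A).mul (h.frameMatrix_contDiffOn l A)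
  · have := congrArg Matrix.det (h.gram_mul_inv hy)
    rw [h.gram_inv hy, Matrix.det_mul, h0] at this
    simp at this

theorem christoffel_contDiffOn (k i j : Fin n) : ContDiffOn ℝ ∞ (christoffel G k i j) V := by
  refine contDiffOn_const.mul (ContDiffOn.sum fun l _ => ContDiffOn.mul ?_ ?_)
  · refine ContDiffOn.congr (f := fun z => ∑ A, frameMatrix E z k A * frameMatrix E z l A)
      (ContDiffOn.sum fun A _ =>
        (h.frameMatrix_contDiffOn k A).mul (h.frameMatrix_contDiffOn l A)) fun y hy => ?_
    simp [h.gram_inv hy, Matrix.mul_apply]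
  · exact ((partialDeriv_contDiffOn h.isOpen (h.gram_contDiffOn _ _) _).add
      (partialDeriv_contDiffOn h.isOpen (h.gram_contDiffOn _ _) _)).sub
      (partialDeriv_contDiffOn h.isOpen (h.gram_contDiffOn _ _) _)

theorem christoffel_symm (hy : y ∈ V) (k i j : Fin n) :
    christoffel G k i j y = christoffel G k j i y := by
  unfold christoffel
  congr 1
  refine Finset.sum_congr rfl fun l _ => ?_
  rw [partialDeriv_congr h.isOpen (fun z hz => h.gram_symm hz i j) hy l]
  ring

theorem connectionMatrix_contDiffOn (i : Fin n) (A B : ι) :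
    ContDiffOn ℝ ∞ (fun z => connectionMatrix G E i z A B) V := by
  simp only [connectionMatrix, coframe, Matrix.mul_apply, Matrix.add_apply,
    Matrix.transpose_apply]
  refine ContDiffOn.sum fun k _ => ContDiffOn.mul (ContDiffOn.sum fun l _ =>
    (h.frameMatrix_contDiffOn _ _).mul (h.gram_contDiffOn _ _)) (ContDiffOn.add ?_
      (ContDiffOn.sum fun l _ => ContDiffOn.mul ?_ (h.frameMatrix_contDiffOn _ _)))
  · exact partialDeriv_contDiffOn h.isOpen (h.frameMatrix_contDiffOn _ _) _
  · exact h.christoffel_contDiffOn _ _ _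

/-- This is `∇_i E_B = ω^A_B(∂ᵢ) E_A` solved for the derivative of the frame: `∂ᵢM = M Wᵢ - Kᵢ M`,
with `W` the connection and `K` the Christoffel matrices. Skewness and the curvature identity both
come from differentiating with it. -/
theorem frameMatrixDeriv_eq (hy : y ∈ V) (i : Fin n) :
    frameMatrixDeriv E i y = frameMatrix E y * connectionMatrix G E i y
      - christoffelMatrix G i y * frameMatrix E y := by
  rw [connectionMatrix, ← Matrix.mul_assoc, h.mul_coframe hy, Matrix.one_mul, add_sub_cancel_right]

theorem lower_christoffel (hy : y ∈ V) (k i j : Fin n) :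
    ∑ l, G y k l * christoffel G l i j y = (1 / 2) * (partialDeriv i (fun z => G z j k) y
      + partialDeriv j (fun z => G z i k) y - partialDeriv k (fun z => G z i j) y) := by
  have key : ∀ u : Fin n → ℝ, ∑ l, G y k l * ((1 / 2) * ∑ m, (G y)⁻¹ l m * u m) =
      (1 / 2) * u k := by
    intro u
    have := congrFun (Matrix.mulVec_mulVec u (G y) ((G y)⁻¹)) k
    rw [h.gram_mul_inv hy, Matrix.one_mulVec] at this
    rw [← this]
    simp only [Matrix.mulVec, dotProduct, Finset.mul_sum]
    exact Finset.sum_congr rfl fun l _ => Finset.sum_congr rfl fun m _ => by ring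
  exact key fun l => partialDeriv i (fun z => G z j l) y + partialDeriv j (fun z => G z i l) y
      - partialDeriv l (fun z => G z i j) y

/-- Metric compatibility in coordinates: of the six terms in the two lowered Christoffel symbols,
four cancel. -/
theorem gram_deriv (hy : y ∈ V) (i : Fin n) :
    (Matrix.of fun j k => partialDeriv i (fun z => G z j k) y) =
      (christoffelMatrix G i y)ᵀ * G y + G y * christoffelMatrix G i y := by
  ext j k
  simp only [Matrix.add_apply, Matrix.mul_apply, Matrix.transpose_apply, christoffelMatrix,
    Matrix.of_apply]
  simp only [fun l => mul_comm (christoffel G l i j y), fun l => h.gram_symm hy l k,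
    h.lower_christoffel hy]
  rw [partialDeriv_congr h.isOpen (fun z hz => h.gram_symm hz k j) hy i]
  ring

/-- Differentiate `Mᵀ G M = 1` and substitute `∂ᵢM = M Wᵢ - Kᵢ M` and `∂ᵢG = Kᵢᵀ G + G Kᵢ`. The
Christoffel terms cancel and `Wᵢᵀ + Wᵢ` remains. -/
theorem connectionMatrix_skew (hy : y ∈ V) (i : Fin n) :
    (connectionMatrix G E i y)ᵀ + connectionMatrix G E i y = 0 := by
  have hd : (frameMatrixDeriv E i y)ᵀ * G y * frameMatrix E y
      + (frameMatrix E y)ᵀ * (Matrix.of fun j k => partialDeriv i (fun z => G z j k) y)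
        * frameMatrix E y
      + (frameMatrix E y)ᵀ * G y * frameMatrixDeriv E i y = 0 := by
    ext A B
    have h0 : partialDeriv i (fun z => ∑ l, (∑ k, frameMatrix E z k A * G z k l)
        * frameMatrix E z l B) y = 0 := by
      rw [partialDeriv_congr h.isOpen (F' := fun _ => if A = B then 1 else 0) ?_ hy i]
      · simp [partialDeriv]
      · intro z hz
        rw [← h.orthonormal z hz A B, Finset.sum_comm]
        simp [frameMatrix, Finset.sum_mul]
    have hM : ∀ k A, DifferentiableAt ℝ (fun z => frameMatrix E z k A) y := fun k A =>
      differentiableAt_of_contDiffOn h.isOpen (h.frameMatrix_contDiffOn k A) hy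
    have hG : ∀ k l, DifferentiableAt ℝ (fun z => G z k l) y := fun k l =>
      differentiableAt_of_contDiffOn h.isOpen (h.gram_contDiffOn k l) hy
    have hMG : ∀ l, DifferentiableAt ℝ (fun z => ∑ k, frameMatrix E z k A * G z k l) y :=
      fun l => DifferentiableAt.fun_sum fun k _ => (hM k A).fun_mul (hG k l)
    rw [partialDeriv_sum fun l => (hMG l).fun_mul (hM l B)] at h0
    simp only [fun l => partialDeriv_mul (hMG l) (hM l B) i,
      fun l => partialDeriv_sum (fun k => (hM k A).fun_mul (hG k l)) i,
      fun l k => partialDeriv_mul (hM k A) (hG k l) i] at h0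
    rw [Matrix.zero_apply, ← h0]
    simp only [Matrix.add_apply, Matrix.mul_apply, Matrix.transpose_apply, Matrix.of_apply,
      frameMatrixDeriv, frameMatrix, Finset.sum_add_distrib, add_mul]
  rw [h.gram_deriv hy, h.frameMatrixDeriv_eq hy] at hd
  have h1 : (frameMatrix E y)ᵀ * G y * frameMatrix E y = 1 := h.coframe_mul hy
  calc _ = (connectionMatrix G E i y)ᵀ * ((frameMatrix E y)ᵀ * G y * frameMatrix E y)
        + ((frameMatrix E y)ᵀ * G y * frameMatrix E y) * connectionMatrix G E i y := by
        rw [h1]; simp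
    _ = _ := by
        rw [← hd]
        simp only [Matrix.transpose_sub, Matrix.transpose_mul, Matrix.sub_mul, Matrix.mul_sub,
          Matrix.mul_add, Matrix.add_mul, Matrix.mul_assoc]
        abel

end IsCoordFrame
end CoordinateFrames

/-! ### Koszul's formula and the curvature form in the frame. -/

section CoordinateFrames

open scoped Topology

variable {n : ℕ} {ι : Type*}

/-- The connection coefficient `⟨∇_{E_A} E_B, E_C⟩`. -/
def frameConn (G : EuclideanSpace ℝ (Fin n) → Matrix (Fin n) (Fin n) ℝ)
    (E : ι → EuclideanSpace ℝ (Fin n) → EuclideanSpace ℝ (Fin n)) (C A B : ι)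
    (y : EuclideanSpace ℝ (Fin n)) : ℝ :=
  ∑ i, frameMatrix E y i A * connectionMatrix G E i y C B

theorem fderiv_euclidean_apply {F : EuclideanSpace ℝ (Fin n) → EuclideanSpace ℝ (Fin n)}
    {y : EuclideanSpace ℝ (Fin n)} (hF : DifferentiableAt ℝ F y) (v : EuclideanSpace ℝ (Fin n))
    (k : Fin n) : (fderiv ℝ F y v) k = fderiv ℝ (fun z => F z k) y v := by
  have := ((EuclideanSpace.proj k : EuclideanSpace ℝ (Fin n) →L[ℝ] ℝ).hasFDerivAt.comp y
    hF.hasFDerivAt).fderiv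
  have h2 : fderiv ℝ (fun z => F z k) y = _ := this
  rw [h2]; rfl

/-- The curvature matrix `(Rˡₖᵢⱼ)ₗₖ`. -/
def riemannMatrix (G : EuclideanSpace ℝ (Fin n) → Matrix (Fin n) (Fin n) ℝ) (i j : Fin n)
    (y : EuclideanSpace ℝ (Fin n)) : Matrix (Fin n) (Fin n) ℝ :=
  Matrix.of fun l k => riemann G l k i j y

/-- The curvature form `∂ᵢω_j - ∂_jωᵢ + [ωᵢ, ω_j]` of the connection matrices. -/
def curvatureMatrix [Fintype ι] (G : EuclideanSpace ℝ (Fin n) → Matrix (Fin n) (Fin n) ℝ)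
    (E : ι → EuclideanSpace ℝ (Fin n) → EuclideanSpace ℝ (Fin n)) (i j : Fin n)
    (y : EuclideanSpace ℝ (Fin n)) : Matrix ι ι ℝ :=
  Matrix.of (fun A B => partialDeriv i (fun z => connectionMatrix G E j z A B) y)
    - Matrix.of (fun A B => partialDeriv j (fun z => connectionMatrix G E i z A B) y)
    + connectionMatrix G E i y * connectionMatrix G E j y
    - connectionMatrix G E j y * connectionMatrix G E i y

namespace IsCoordFrame

variable [Fintype ι] [DecidableEq ι] {V : Set (EuclideanSpace ℝ (Fin n))}
  {G : EuclideanSpace ℝ (Fin n) → Matrix (Fin n) (Fin n) ℝ}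
  {E : ι → EuclideanSpace ℝ (Fin n) → EuclideanSpace ℝ (Fin n)}
  {c : ι → ι → ι → EuclideanSpace ℝ (Fin n) → ℝ} (h : IsCoordFrame V G E c)
  {y : EuclideanSpace ℝ (Fin n)}

include h

theorem lieBracket_apply (hy : y ∈ V) (A B : ι) (k : Fin n) :
    VectorField.lieBracket ℝ (E A) (E B) y k =
      ∑ i, (frameMatrix E y i A * frameMatrixDeriv E i y k B
        - frameMatrix E y i B * frameMatrixDeriv E i y k A) := by
  have hd : ∀ A, DifferentiableAt ℝ (E A) y := fun A =>
    ((h.smooth A).differentiableOn (by simp) y hy).differentiableAt (h.isOpen.mem_nhds hy)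
  rw [VectorField.lieBracket_eq]
  simp only [PiLp.sub_apply, fderiv_euclidean_apply (hd _), fderiv_eq_sum_partialDeriv,
    Finset.sum_sub_distrib]
  rfl

theorem structure_eq (hy : y ∈ V) (C A B : ι) :
    c C A B y = ∑ k, coframe G E y C k * VectorField.lieBracket ℝ (E A) (E B) y k := by
  have h1 : ∀ k, VectorField.lieBracket ℝ (E A) (E B) y k =
      (frameMatrix E y *ᵥ fun D => c D A B y) k := by
    intro k
    rw [h.bracket y hy A B]
    simp [Matrix.mulVec, dotProduct, frameMatrix, mul_comm]
  have h2 := congrFun (Matrix.mulVec_mulVec (fun D => c D A B y) (coframe G E y)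
    (frameMatrix E y)) C
  rw [h.coframe_mul hy, Matrix.one_mulVec] at h2
  simp only [h1]
  exact h2.symm

/-- The coframe recovers `c` from the bracket, so the smoothness of the frame passes to the
structure functions. -/
theorem structure_contDiffOn (C A B : ι) : ContDiffOn ℝ ∞ (c C A B) V := by
  refine ContDiffOn.congr (f := fun z => ∑ k, (∑ l, frameMatrix E z l C * G z l k) *
    ∑ i, (frameMatrix E z i A * partialDeriv i (fun w => E B w k) z
        - frameMatrix E z i B * partialDeriv i (fun w => E A w k) z)) ?_ fun z hz => ?_
  · have hp : ∀ i k A, ContDiffOn ℝ ∞ (partialDeriv i (fun w => E A w k)) V := fun i k A =>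
      partialDeriv_contDiffOn h.isOpen (h.frameMatrix_contDiffOn k A) i
    exact ContDiffOn.sum fun k _ => (ContDiffOn.sum fun l _ =>
      (h.frameMatrix_contDiffOn _ _).mul (h.gram_contDiffOn _ _)).mul (ContDiffOn.sum fun i _ =>
        ((h.frameMatrix_contDiffOn _ _).mul (hp _ _ _)).sub
          ((h.frameMatrix_contDiffOn _ _).mul (hp _ _ _)))
  · rw [h.structure_eq hz]
    simp only [h.lieBracket_apply hz]
    rfl

/-- Torsion-freeness: the Christoffel part is symmetric in the two arguments and drops out, leaving
the coordinate expression of the bracket. -/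
theorem frameConn_sub (hy : y ∈ V) (C A B : ι) :
    frameConn G E C A B y - frameConn G E C B A y = c C A B y := by
  have key : ∀ A B, frameConn G E C A B y = ∑ k, coframe G E y C k *
      (∑ i, frameMatrix E y i A * frameMatrixDeriv E i y k B
        + ∑ i, ∑ j, christoffel G k i j y * frameMatrix E y i A * frameMatrix E y j B) := by
    intro A B
    simp only [frameConn, connectionMatrix, Matrix.mul_apply (N := _ + _), Finset.mul_sum,
      ← Finset.sum_add_distrib]
    rw [Finset.sum_comm]
    refine Finset.sum_congr rfl fun k _ => Finset.sum_congr rfl fun i _ => ?_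
    simp only [Matrix.add_apply, Matrix.mul_apply (M := christoffelMatrix G i y), mul_add,
      Finset.mul_sum]
    congr 1
    · ring
    · exact Finset.sum_congr rfl fun j _ => by simp only [christoffelMatrix, Matrix.of_apply]; ring
  rw [h.structure_eq hy, key, key, ← Finset.sum_sub_distrib]
  refine Finset.sum_congr rfl fun k _ => ?_
  have hs : ∑ i, ∑ j, christoffel G k i j y * frameMatrix E y i B * frameMatrix E y j A
      = ∑ i, ∑ j, christoffel G k i j y * frameMatrix E y i A * frameMatrix E y j B := by
    rw [Finset.sum_comm]
    exact Finset.sum_congr rfl fun i _ => Finset.sum_congr rfl fun j _ => by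
      rw [h.christoffel_symm hy k j i]; ring
  rw [h.lieBracket_apply hy, hs, Finset.sum_sub_distrib]
  ring

theorem frameConn_skew (hy : y ∈ V) (C A B : ι) :
    frameConn G E C A B y = -frameConn G E B A C y := by
  simp only [frameConn, ← Finset.sum_neg_distrib]
  refine Finset.sum_congr rfl fun i _ => ?_
  have := congrFun (congrFun (h.connectionMatrix_skew hy i) C) B
  simp only [Matrix.add_apply, Matrix.transpose_apply, Matrix.zero_apply] at this
  rw [eq_neg_of_add_eq_zero_right this]; ring

/-- Koszul's formula in an orthonormal frame. -/
theorem frameConn_eq (hy : y ∈ V) (C A B : ι) :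
    frameConn G E C A B y = (1 / 2) * (c C A B y - c A B C y + c B C A y) := by
  rw [← h.frameConn_sub hy C A B, ← h.frameConn_sub hy A B C, ← h.frameConn_sub hy B C A,
    h.frameConn_skew hy C B A, h.frameConn_skew hy A C B, h.frameConn_skew hy B A C]
  ring

/-- Curvature is the obstruction to commuting derivatives. Differentiating `∂ⱼM = M Wⱼ - Kⱼ M` along
`i` and antisymmetrising, the left side vanishes by symmetry of second derivatives, while the right
side collapses to `M Ω - R M`. -/
theorem riemannMatrix_mul (hy : y ∈ V) (i j : Fin n) :
    riemannMatrix G i j y * frameMatrix E y = frameMatrix E y * curvatureMatrix G E i j y := by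
  set M := frameMatrix E y
  set W := fun i => connectionMatrix G E i y
  set K := fun i => christoffelMatrix G i y
  set dM := fun i => frameMatrixDeriv E i y
  set dW := fun i j => Matrix.of fun A B => partialDeriv i (fun z => connectionMatrix G E j z A B) y
  set dK := fun i j => Matrix.of fun l k => partialDeriv i (christoffel G l j k) y
  have hR : riemannMatrix G i j y = dK i j - dK j i + K i * K j - K j * K i := by
    ext l k
    simp only [riemannMatrix, riemann, Matrix.of_apply, Matrix.sub_apply, Matrix.add_apply,
      Matrix.mul_apply, dK, K, christoffelMatrix, Finset.sum_sub_distrib]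
    ring
  have hΩ : curvatureMatrix G E i j y = dW i j - dW j i + W i * W j - W j * W i := rfl
  have hdM : ∀ i, dM i = M * W i - K i * M := fun i => h.frameMatrixDeriv_eq hy i
  have hMd : ∀ k A, DifferentiableAt ℝ (fun z => frameMatrix E z k A) y := fun k A =>
    differentiableAt_of_contDiffOn h.isOpen (h.frameMatrix_contDiffOn k A) hy
  have hWd : ∀ i A B, DifferentiableAt ℝ (fun z => connectionMatrix G E i z A B) y :=
    fun i A B => differentiableAt_of_contDiffOn h.isOpen (h.connectionMatrix_contDiffOn i A B) hy
  have hKd : ∀ k i j, DifferentiableAt ℝ (fun z => christoffel G k i j z) y :=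
    fun k i j => differentiableAt_of_contDiffOn h.isOpen (h.christoffel_contDiffOn k i j) hy
  have hdd : ∀ i j, (Matrix.of fun k B => partialDeriv i
      (partialDeriv j (fun z => frameMatrix E z k B)) y) =
      dM i * W j + M * dW i j - dK i j * M - K j * dM i := by
    intro i j
    ext k B
    rw [Matrix.of_apply, partialDeriv_congr h.isOpen (F' := fun z =>
      ∑ C, frameMatrix E z k C * connectionMatrix G E j z C B
        - ∑ l, christoffel G k j l z * frameMatrix E z l B) ?_ hy i]
    · rw [partialDeriv_sub (DifferentiableAt.fun_sum fun C _ => (hMd k C).fun_mul (hWd j C B))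
          (DifferentiableAt.fun_sum fun l _ => (hKd k j l).fun_mul (hMd l B)),
        partialDeriv_sum fun C => (hMd k C).fun_mul (hWd j C B),
        partialDeriv_sum fun l => (hKd k j l).fun_mul (hMd l B)]
      simp only [fun C => partialDeriv_mul (hMd k C) (hWd j C B) i,
        fun l => partialDeriv_mul (hKd k j l) (hMd l B) i, Finset.sum_add_distrib]
      simp only [Matrix.sub_apply, Matrix.add_apply, Matrix.mul_apply, sub_sub]
      rfl
    · intro z hz
      have := congrFun (congrFun (h.frameMatrixDeriv_eq hz j) k) B
      simp only [Matrix.sub_apply, Matrix.mul_apply] at this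
      exact this
  have hsymm : dM i * W j + M * dW i j - dK i j * M - K j * dM i =
      dM j * W i + M * dW j i - dK j i * M - K i * dM j := by
    rw [← hdd, ← hdd]
    ext k B
    exact partialDeriv_comm h.isOpen (h.frameMatrix_contDiffOn k B) hy i j
  rw [hdM, hdM] at hsymm
  rw [hR, hΩ, ← sub_eq_zero]
  rw [← sub_eq_zero] at hsymm
  rw [← neg_eq_zero, ← hsymm]
  simp only [Matrix.sub_mul, Matrix.mul_sub, Matrix.mul_add, Matrix.add_mul, Matrix.mul_assoc]
  abel

/-- Since `G⁻¹ = M Mᵀ`, the metric trace becomes a sum over frame vectors, and `R M = M Ω` converts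
the remaining trace. The scalar curvature is thus `∑ Ω^B_A(E_B, E_A)`. -/
theorem coordScalarCurvature_eq_sum (hy : y ∈ V) :
    coordScalarCurvature G y = ∑ A, ∑ B, ∑ i, ∑ j,
      frameMatrix E y i B * frameMatrix E y j A * curvatureMatrix G E i j y B A := by
  have key : ∀ A i j, ∑ B, frameMatrix E y i B * curvatureMatrix G E i j y B A =
      ∑ k, riemann G i k i j y * frameMatrix E y k A := by
    intro A i j
    have := congrFun (congrFun (h.riemannMatrix_mul hy i j) i) A
    simp only [Matrix.mul_apply] at this
    exact this.symm
  calc coordScalarCurvature G y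
      = ∑ j, ∑ k, ∑ i, ∑ A,
        frameMatrix E y j A * (riemann G i k i j y * frameMatrix E y k A) := by
        simp only [coordScalarCurvature, ricci, h.gram_inv hy, Matrix.mul_apply,
          Matrix.transpose_apply, Finset.mul_sum, Finset.sum_mul]
        refine Finset.sum_congr rfl fun j _ => Finset.sum_congr rfl fun k _ =>
          Finset.sum_congr rfl fun i _ => Finset.sum_congr rfl fun A _ => by ring
    _ = ∑ A, ∑ i, ∑ j, frameMatrix E y j A *
          ∑ k, riemann G i k i j y * frameMatrix E y k A := by
        simp only [Finset.mul_sum]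
        rw [Finset.sum_congr rfl fun j _ => Finset.sum_congr rfl fun k _ => Finset.sum_comm,
          Finset.sum_congr rfl fun j _ => Finset.sum_comm, Finset.sum_comm]
        refine Finset.sum_congr rfl fun A _ => ?_
        rw [Finset.sum_congr rfl fun j _ => Finset.sum_comm, Finset.sum_comm]
    _ = _ := by
        simp only [← key, Finset.mul_sum]
        refine Finset.sum_congr rfl fun A _ => ?_
        rw [Finset.sum_congr rfl fun i _ => Finset.sum_comm, Finset.sum_comm]
        refine Finset.sum_congr rfl fun B _ => Finset.sum_congr rfl fun i _ =>
          Finset.sum_congr rfl fun j _ => by ring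

theorem fderiv_frameConn (hy : y ∈ V) (C A B : ι) (v : EuclideanSpace ℝ (Fin n)) :
    fderiv ℝ (frameConn G E C A B) y v = ∑ i, ∑ j, v i *
      (frameMatrixDeriv E i y j A * connectionMatrix G E j y C B + frameMatrix E y j A *
        partialDeriv i (fun z => connectionMatrix G E j z C B) y) := by
  have hMd : ∀ k A, DifferentiableAt ℝ (fun z => frameMatrix E z k A) y := fun k A =>
    differentiableAt_of_contDiffOn h.isOpen (h.frameMatrix_contDiffOn k A) hy
  have hWd : ∀ i A B, DifferentiableAt ℝ (fun z => connectionMatrix G E i z A B) y :=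
    fun i A B => differentiableAt_of_contDiffOn h.isOpen (h.connectionMatrix_contDiffOn i A B) hy
  rw [fderiv_eq_sum_partialDeriv]
  refine Finset.sum_congr rfl fun i _ => ?_
  rw [← Finset.mul_sum]
  congr 1
  refine (partialDeriv_sum (F := fun j z => frameMatrix E z j A * connectionMatrix G E j z C B)
    (fun j => (hMd j A).fun_mul (hWd j C B)) i).trans ?_
  exact Finset.sum_congr rfl fun j _ => partialDeriv_mul (hMd j A) (hWd j C B) i

/-- Cartan's `dω(X, Y) = X(ω(Y)) - Y(ω(X)) - ω([X, Y])`, applied to the frame vectors: the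
derivatives of `Γ` also hit the frame, and those extra terms assemble into `[E_B, E_A]`, that is
into `c^C_{BA} Γ^B_{CA}`. -/
theorem sum_curvatureMatrix (hy : y ∈ V) (A B : ι) :
    ∑ i, ∑ j, frameMatrix E y i B * frameMatrix E y j A * curvatureMatrix G E i j y B A =
      fderiv ℝ (frameConn G E B A A) y (E B y) - fderiv ℝ (frameConn G E B B A) y (E A y)
      + ∑ C, (frameConn G E B B C y * frameConn G E C A A y
        - frameConn G E B A C y * frameConn G E C B A y - c C B A y * frameConn G E B C A y) := by
  have hprod : ∀ P Q R S : ι, ∑ i, ∑ j, frameMatrix E y i P * frameMatrix E y j Q *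
      (∑ C, connectionMatrix G E i y R C * connectionMatrix G E j y C S) =
      ∑ C, frameConn G E R P C y * frameConn G E C Q S y := by
    intro P Q R S
    simp only [Finset.mul_sum]
    rw [Finset.sum_congr rfl fun i _ => Finset.sum_comm, Finset.sum_comm]
    refine Finset.sum_congr rfl fun C _ => ?_
    rw [frameConn, frameConn, Finset.sum_mul_sum]
    exact Finset.sum_congr rfl fun i _ => Finset.sum_congr rfl fun j _ => by ring
  have hc : ∑ C, c C B A y * frameConn G E B C A y = ∑ i, ∑ j,
      (frameMatrix E y i B * frameMatrixDeriv E i y j A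
        - frameMatrix E y i A * frameMatrixDeriv E i y j B) * connectionMatrix G E j y B A := by
    have h1 : ∀ j, ∑ C, frameMatrix E y j C * c C B A y =
        ∑ i, (frameMatrix E y i B * frameMatrixDeriv E i y j A
        - frameMatrix E y i A * frameMatrixDeriv E i y j B) := by
      intro j
      rw [← h.lieBracket_apply hy B A j, h.bracket y hy B A]
      simp [frameMatrix, mul_comm]
    rw [Finset.sum_comm]
    simp only [← Finset.sum_mul, ← h1]
    simp only [frameConn, Finset.mul_sum, Finset.sum_mul]
    rw [Finset.sum_comm]
    exact Finset.sum_congr rfl fun C _ => Finset.sum_congr rfl fun i _ => by ring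
  simp only [Finset.sum_sub_distrib]
  rw [← hprod B A B A, hc, h.fderiv_frameConn hy, h.fderiv_frameConn hy]
  have hq : ∑ C, frameConn G E B A C y * frameConn G E C B A y = ∑ i, ∑ j,
      frameMatrix E y i B * frameMatrix E y j A *
      (∑ C, connectionMatrix G E j y B C * connectionMatrix G E i y C A) := by
    rw [← hprod A B B A, Finset.sum_comm]
    exact Finset.sum_congr rfl fun i _ => Finset.sum_congr rfl fun j _ => by ring
  have hw : ∑ i, ∑ j, E A y i * (frameMatrix E y j B *
        partialDeriv i (fun z => connectionMatrix G E j z B A) y) =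
      ∑ i, ∑ j, E A y j * (frameMatrix E y i B *
        partialDeriv j (fun z => connectionMatrix G E i z B A) y) := Finset.sum_comm
  rw [hq]
  simp only [mul_add, Finset.sum_add_distrib]
  rw [hw]
  simp only [← Finset.sum_add_distrib, ← Finset.sum_sub_distrib]
  refine Finset.sum_congr rfl fun i _ => Finset.sum_congr rfl fun j _ => ?_
  simp only [curvatureMatrix, Matrix.add_apply, Matrix.sub_apply, Matrix.mul_apply,
    Matrix.of_apply]
  simp only [frameMatrix, Matrix.of_apply]
  ring

end IsCoordFrame
end CoordinateFrames

/-! ### Scalar curvature as a function of the structure functions. -/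

section FrameFormula

open scoped Topology

variable {n : ℕ} {ι : Type*} [Fintype ι]

/-- The terms without derivatives in the scalar curvature of a metric with an orthonormal frame
whose structure functions are `c C A B`, in the form
`-(c^B_{AB} c^C_{AC} + ½ c^C_{AB} c^B_{AC} + ¼ c^C_{AB} c^C_{AB})`. -/
def structureQuadratic (c : ι → ι → ι → ℝ) : ℝ :=
  -∑ A, ∑ B, ∑ C, (c B A B * c C A C + (1 / 2) * (c C A B * c B A C)
    + (1 / 4) * (c C A B * c C A B))

theorem sum_swap_right (F : ι → ι → ι → ℝ) :
    ∑ j, ∑ k, ∑ l, F j l k = ∑ j, ∑ k, ∑ l, F j k l :=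
  Finset.sum_congr rfl fun _ _ => Finset.sum_comm

theorem sum_swap_left (F : ι → ι → ι → ℝ) :
    ∑ j, ∑ k, ∑ l, F k j l = ∑ j, ∑ k, ∑ l, F j k l :=
  Finset.sum_comm

/-- Pure algebra, using only antisymmetry of `c` and Koszul's formula. After relabelling, every
product is of one of three kinds: products of traces (`e1`), Killing-type products (`eP1`–`eP3`) and
squares (`eQ1`–`eQ3`). Being free of geometry, it applies also to a sub-bundle that is not
integrable. -/
theorem sum_connCoeff_quadratic (c : ι → ι → ι → ℝ) (hc : ∀ C A B, c C A B = -c C B A)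
    (g : ι → ι → ι → ℝ) (hg : ∀ C A B, g C A B = (1 / 2) * (c C A B - c A B C + c B C A)) :
    ∑ j, ∑ k, ∑ l, (g k k l * g l j j - g k j l * g l k j - c l k j * g k l j) =
      structureQuadratic c := by
  have h0 : ∀ C A, c C A A = 0 := fun C A => by linarith [hc C A A]
  have e1 : ∑ j, ∑ k, ∑ l, g k k l * g l j j = -∑ A, ∑ B, ∑ C, c B A B * c C A C := by
    rw [← sum_swap_right, ← sum_swap_left]
    simp only [← Finset.sum_neg_distrib]
    refine Finset.sum_congr rfl fun l _ => Finset.sum_congr rfl fun j _ =>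
      Finset.sum_congr rfl fun k _ => ?_
    rw [hg, hg, h0, h0, hc j j l, hc k k l]
    ring
  have eP1 : ∑ j, ∑ k, ∑ l, c k j l * c j l k = -∑ A, ∑ B, ∑ C, c C A B * c B A C := by
    rw [← sum_swap_left fun A B C => c C A B * c B A C,
      ← sum_swap_right fun B A C => c C A B * c B A C]
    simp only [← Finset.sum_neg_distrib]
    refine Finset.sum_congr rfl fun j _ => Finset.sum_congr rfl fun k _ =>
      Finset.sum_congr rfl fun l _ => ?_
    rw [hc k j l]; ring
  have eP2 : ∑ j, ∑ k, ∑ l, c k j l * c l k j = -∑ A, ∑ B, ∑ C, c C A B * c B A C := by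
    rw [← sum_swap_right fun A B C => c C A B * c B A C]
    simp only [← Finset.sum_neg_distrib]
    refine Finset.sum_congr rfl fun j _ => Finset.sum_congr rfl fun k _ =>
      Finset.sum_congr rfl fun l _ => ?_
    rw [hc l k j]; ring
  have eP3 : ∑ j, ∑ k, ∑ l, c j l k * c l k j = -∑ A, ∑ B, ∑ C, c C A B * c B A C := by
    rw [← sum_swap_left fun A B C => c C A B * c B A C]
    simp only [← Finset.sum_neg_distrib]
    refine Finset.sum_congr rfl fun j _ => Finset.sum_congr rfl fun k _ =>
      Finset.sum_congr rfl fun l _ => ?_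
    rw [hc j l k, hc l k j]; ring
  have eQ1 : ∑ j, ∑ k, ∑ l, c k j l * c k j l = ∑ A, ∑ B, ∑ C, c C A B * c C A B :=
    sum_swap_right fun A B C => c C A B * c C A B
  have eQ2 : ∑ j, ∑ k, ∑ l, c j l k * c j l k = ∑ A, ∑ B, ∑ C, c C A B * c C A B := by
    rw [← sum_swap_right fun A B C => c C A B * c C A B,
      ← sum_swap_left fun A C B => c C A B * c C A B]
    refine Finset.sum_congr rfl fun j _ => Finset.sum_congr rfl fun k _ =>
      Finset.sum_congr rfl fun l _ => ?_
    rw [hc j l k]; ring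
  have eQ3 : ∑ j, ∑ k, ∑ l, c l k j * c l k j = ∑ A, ∑ B, ∑ C, c C A B * c C A B :=
    sum_swap_left fun A B C => c C A B * c C A B
  have hexp : ∀ j k l, g k k l * g l j j - g k j l * g l k j - c l k j * g k l j =
      g k k l * g l j j + (1 / 4) * (c k j l * c k j l) + (1 / 4) * (c j l k * c j l k)
      - (3 / 4) * (c l k j * c l k j) - (1 / 2) * (c k j l * c j l k)
      + (1 / 2) * (c k j l * c l k j) + (1 / 2) * (c j l k * c l k j) := by
    intro j k l
    rw [hg k j l, hg l k j, hg k l j, hc k l j, hc l j k, hc j k l]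
    ring
  simp only [hexp, Finset.sum_add_distrib, Finset.sum_sub_distrib, ← Finset.mul_sum]
  rw [e1, eP1, eP2, eP3, eQ1, eQ2, eQ3]
  simp only [structureQuadratic, Finset.sum_add_distrib, ← Finset.mul_sum]
  ring

/-- Because `c^C_{AA} = 0`, the differentiated coefficients are single structure functions,
`Γ^B_{AA} = c^A_{BA}` and `Γ^B_{BA} = -c^B_{AB}`. The two derivative sums therefore agree up to
relabelling, whence the factor `2`. -/
theorem IsCoordFrame.coordScalarCurvature_eq [DecidableEq ι]
    {V : Set (EuclideanSpace ℝ (Fin n))}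
    {G : EuclideanSpace ℝ (Fin n) → Matrix (Fin n) (Fin n) ℝ}
    {E : ι → EuclideanSpace ℝ (Fin n) → EuclideanSpace ℝ (Fin n)}
    {c : ι → ι → ι → EuclideanSpace ℝ (Fin n) → ℝ} (h : IsCoordFrame V G E c)
    {y : EuclideanSpace ℝ (Fin n)} (hy : y ∈ V) :
    coordScalarCurvature G y = 2 * ∑ A, ∑ B, fderiv ℝ (c B A B) y (E A y)
      + structureQuadratic fun C A B => c C A B y := by
  have h0 : ∀ C A y, c C A A y = 0 := fun C A y => by linarith [h.antisymm C A A y]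
  have hnear : ∀ {F F' : EuclideanSpace ℝ (Fin n) → ℝ}, (∀ z ∈ V, F z = F' z) →
      fderiv ℝ F y = fderiv ℝ F' y := fun hF =>
    (Filter.eventuallyEq_of_mem (h.isOpen.mem_nhds hy) hF).fderiv_eq
  have h1 : ∀ A B, fderiv ℝ (frameConn G E B A A) y = fderiv ℝ (c A B A) y := fun A B =>
    hnear fun z hz => by
      rw [h.frameConn_eq hz, h0, h.antisymm A A B]; ring
  have h2 : ∀ A B, fderiv ℝ (frameConn G E B B A) y = -fderiv ℝ (c B A B) y := fun A B => by
    rw [← fderiv_fun_neg]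
    exact hnear fun z hz => by
      rw [h.frameConn_eq hz, h0, h.antisymm B B A]; ring
  rw [h.coordScalarCurvature_eq_sum hy, ← sum_connCoeff_quadratic _
    (fun C A B => h.antisymm C A B y) _ fun C A B => h.frameConn_eq hy C A B]
  simp only [h.sum_curvatureMatrix hy, h1, h2, Finset.sum_add_distrib (ι := ι)]
  congr 1
  simp only [neg_apply, sub_neg_eq_add, Finset.sum_add_distrib]
  rw [Finset.sum_comm, two_mul]

section Manifold

variable {M : Type*} [TopologicalSpace M] [ChartedSpace (EuclideanSpace ℝ (Fin n)) M]
  [RiemannianBundle (fun x : M => TangentSpace (𝓡 n) x)]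

theorem structureFn_antisymm {κ : Type*} (e : κ → ∀ x : M, TangentSpace (𝓡 n) x) (C A B : κ)
    (x : M) : structureFn e C A B x = -structureFn e C B A x := by
  rw [structureFn, VectorField.mlieBracket_swap_apply, inner_neg_left]; rfl

theorem blockScalarCurvature_eq (e : ι → ∀ x : M, TangentSpace (𝓡 n) x) (x : M) :
    blockScalarCurvature e x = 2 * ∑ A, ∑ B, dirDeriv (e A) (structureFn e B A B) x
      + structureQuadratic fun C A B => structureFn e C A B x := by
  have h0 : ∀ C A y, structureFn e C A A y = 0 := fun C A y => by
    linarith [structureFn_antisymm e C A A y]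
  have h1 : ∀ A B, connCoeff e B A A = structureFn e A B A := fun A B => by
    funext z
    rw [connCoeff, h0, structureFn_antisymm e A A B]; ring
  have h2 : ∀ A B, connCoeff e B B A = -structureFn e B A B := fun A B => by
    funext z
    rw [connCoeff, h0, structureFn_antisymm e B B A, Pi.neg_apply]; ring
  rw [← sum_connCoeff_quadratic _ (fun C A B => structureFn_antisymm e C A B x)
    (fun C A B => connCoeff e C A B x) fun C A B => rfl]
  have h3 : ∀ (W : ∀ x : M, TangentSpace (𝓡 n) x) (F : M → ℝ),
      dirDeriv W (-F) x = -dirDeriv W F x := by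
    intro W F
    simp only [dirDeriv]
    rw [mfderiv_neg]; rfl
  simp only [blockScalarCurvature]
  simp only [Finset.sum_add_distrib (ι := ι), h1, h2, h3]
  congr 1
  simp only [sub_neg_eq_add, Finset.sum_add_distrib]
  rw [Finset.sum_comm, two_mul]

end Manifold

end FrameFormula

/-! ### Splitting the rescaled quadratic terms into Roman and Greek blocks. -/

section BlockDecomposition

open Sum

variable {κ τ : Type*}

/-- The factor by which the vectors of an adapted orthonormal frame have to be multiplied to become
orthonormal for the collapsed metric. -/
def frameScale (f : ℝ) : κ ⊕ τ → ℝ := Sum.elim (fun _ => 1) fun _ => f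

theorem frameScale_ne_zero {f : ℝ} (hf : f ≠ 0) (A : κ ⊕ τ) : frameScale f A ≠ 0 := by
  cases A <;> simp [frameScale, hf]

variable [Fintype κ] [Fintype τ]

theorem sum_frameScale_sq (F : κ ⊕ τ → κ ⊕ τ → κ ⊕ τ → ℝ) (f : ℝ) :
    ∑ A, ∑ B, ∑ C, frameScale f A ^ 2 * F A B C =
      (∑ i, ∑ j, ∑ k, F (inl i) (inl j) (inl k)) + (∑ i, ∑ j, ∑ γ, F (inl i) (inl j) (inr γ))
      + (∑ i, ∑ γ, ∑ j, F (inl i) (inr γ) (inl j)) + (∑ i, ∑ γ, ∑ β, F (inl i) (inr γ) (inr β))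
      + f ^ 2 * ((∑ α, ∑ j, ∑ k, F (inr α) (inl j) (inl k))
        + (∑ α, ∑ k, ∑ β, F (inr α) (inl k) (inr β)) + (∑ α, ∑ β, ∑ k, F (inr α) (inr β) (inl k))
        + ∑ α, ∑ β, ∑ γ, F (inr α) (inr β) (inr γ)) := by
  simp only [Fintype.sum_sum_type, frameScale, Sum.elim_inl, Sum.elim_inr, one_pow, one_mul,
    Finset.sum_add_distrib, ← Finset.mul_sum]
  ring

theorem sum_trace_scaled (c : κ ⊕ τ → κ ⊕ τ → κ ⊕ τ → ℝ) (f : ℝ) :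
    ∑ A, ∑ B, ∑ C, frameScale f A ^ 2 * (c B A B * c C A C) =
      (∑ i, ∑ j, ∑ k, c (inl j) (inl i) (inl j) * c (inl k) (inl i) (inl k))
      + f ^ 2 * (∑ α, ∑ β, ∑ γ, c (inr β) (inr α) (inr β) * c (inr γ) (inr α) (inr γ))
      + f ^ 2 * (∑ α, ∑ k, ∑ j, c (inl k) (inr α) (inl k) * c (inl j) (inr α) (inl j))
      + 2 * f ^ 2 * (∑ α, ∑ k, ∑ β, c (inl k) (inr α) (inl k) * c (inr β) (inr α) (inr β))
      + (∑ i, ∑ γ, ∑ β, c (inr γ) (inl i) (inr γ) * c (inr β) (inl i) (inr β))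
      + 2 * (∑ i, ∑ γ, ∑ j, c (inr γ) (inl i) (inr γ) * c (inl j) (inl i) (inl j)) := by
  have h1 : ∑ i, ∑ j, ∑ γ, c (inl j) (inl i) (inl j) * c (inr γ) (inl i) (inr γ) =
      ∑ i, ∑ γ, ∑ j, c (inr γ) (inl i) (inr γ) * c (inl j) (inl i) (inl j) :=
    Finset.sum_congr rfl fun i _ => by
      rw [Finset.sum_comm]
      exact Finset.sum_congr rfl fun _ _ => Finset.sum_congr rfl fun _ _ => mul_comm _ _
  have h2 : ∑ α, ∑ β, ∑ k, c (inr β) (inr α) (inr β) * c (inl k) (inr α) (inl k) =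
      ∑ α, ∑ k, ∑ β, c (inl k) (inr α) (inl k) * c (inr β) (inr α) (inr β) :=
    Finset.sum_congr rfl fun i _ => by
      rw [Finset.sum_comm]
      exact Finset.sum_congr rfl fun _ _ => Finset.sum_congr rfl fun _ _ => mul_comm _ _
  rw [sum_frameScale_sq fun A B C => c B A B * c C A C, h1, h2]
  ring

/-- The summand is symmetric under exchanging `B` and `C`, so the blocks where these have different
types occur in equal pairs; this is the source of the factors `2`. -/
theorem sum_killing_scaled (c : κ ⊕ τ → κ ⊕ τ → κ ⊕ τ → ℝ) (hc : ∀ C A B, c C A B = -c C B A)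
    (f : ℝ) :
    ∑ A, ∑ B, ∑ C, frameScale f A ^ 2 * (c C A B * c B A C) =
      (∑ i, ∑ j, ∑ k, c (inl k) (inl i) (inl j) * c (inl j) (inl i) (inl k))
      + f ^ 2 * (∑ α, ∑ β, ∑ γ, c (inr γ) (inr α) (inr β) * c (inr β) (inr α) (inr γ))
      + f ^ 2 * (∑ i, ∑ k, ∑ β, c (inl k) (inl i) (inr β) * c (inl i) (inl k) (inr β))
      + 2 * f ^ 2 * (∑ i, ∑ γ, ∑ β, c (inl i) (inr γ) (inr β) * c (inr γ) (inl i) (inr β))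
      + (∑ α, ∑ γ, ∑ j, c (inr α) (inr γ) (inl j) * c (inr γ) (inr α) (inl j))
      + 2 * (∑ i, ∑ γ, ∑ j, c (inl i) (inr γ) (inl j) * c (inr γ) (inl i) (inl j)) := by
  have h1 : ∑ β, ∑ i, ∑ k, c (inl k) (inr β) (inl i) * c (inl i) (inr β) (inl k) =
      ∑ i, ∑ k, ∑ β, c (inl k) (inl i) (inr β) * c (inl i) (inl k) (inr β) := by
    rw [Finset.sum_comm]
    refine Finset.sum_congr rfl fun i _ => ?_
    rw [Finset.sum_comm]
    exact Finset.sum_congr rfl fun k _ => Finset.sum_congr rfl fun β _ => by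
      rw [hc (inl k) (inr β), hc (inl i) (inr β)]; ring
  have h2 : ∑ γ, ∑ β, ∑ i, c (inl i) (inr γ) (inr β) * c (inr β) (inr γ) (inl i) =
      ∑ i, ∑ γ, ∑ β, c (inl i) (inr γ) (inr β) * c (inr γ) (inl i) (inr β) := by
    rw [Finset.sum_congr rfl fun γ _ => Finset.sum_comm, Finset.sum_comm]
    refine Finset.sum_congr rfl fun i _ => ?_
    rw [Finset.sum_comm]
    exact Finset.sum_congr rfl fun γ _ => Finset.sum_congr rfl fun β _ => by
      rw [hc (inl i) (inr β), hc (inr γ) (inr β)]; ring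
  have h2' : ∑ γ, ∑ i, ∑ β, c (inr β) (inr γ) (inl i) * c (inl i) (inr γ) (inr β) =
      ∑ i, ∑ γ, ∑ β, c (inl i) (inr γ) (inr β) * c (inr γ) (inl i) (inr β) := by
    rw [← h2]
    refine Finset.sum_congr rfl fun γ _ => ?_
    rw [Finset.sum_comm]
    exact Finset.sum_congr rfl fun _ _ => Finset.sum_congr rfl fun _ _ => mul_comm _ _
  have h3 : ∑ j, ∑ α, ∑ γ, c (inr γ) (inl j) (inr α) * c (inr α) (inl j) (inr γ) =
      ∑ α, ∑ γ, ∑ j, c (inr α) (inr γ) (inl j) * c (inr γ) (inr α) (inl j) := by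
    rw [Finset.sum_comm]
    refine Finset.sum_congr rfl fun α _ => ?_
    rw [Finset.sum_comm]
    exact Finset.sum_congr rfl fun γ _ => Finset.sum_congr rfl fun j _ => by
      rw [hc (inr γ) (inl j), hc (inr α) (inl j)]; ring
  have h4 : ∑ i, ∑ γ, ∑ j, c (inl j) (inl i) (inr γ) * c (inr γ) (inl i) (inl j) =
      ∑ i, ∑ γ, ∑ j, c (inl i) (inr γ) (inl j) * c (inr γ) (inl i) (inl j) := by
    rw [Finset.sum_congr rfl fun i _ => Finset.sum_comm, Finset.sum_comm]
    refine Finset.sum_congr rfl fun i _ => ?_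
    rw [Finset.sum_comm]
    exact Finset.sum_congr rfl fun γ _ => Finset.sum_congr rfl fun j _ => by
      rw [hc (inl i) (inl j), hc (inr γ) (inl j)]; ring
  have h4' : ∑ i, ∑ j, ∑ γ, c (inr γ) (inl i) (inl j) * c (inl j) (inl i) (inr γ) =
      ∑ i, ∑ γ, ∑ j, c (inl i) (inr γ) (inl j) * c (inr γ) (inl i) (inl j) := by
    rw [← h4]
    refine Finset.sum_congr rfl fun γ _ => ?_
    rw [Finset.sum_comm]
    exact Finset.sum_congr rfl fun _ _ => Finset.sum_congr rfl fun _ _ => mul_comm _ _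
  rw [sum_frameScale_sq fun A B C => c C A B * c B A C, h1, h2, h2', h3, h4, h4']
  ring

/-- Here the weight depends on all three indices, and only this sum produces `f⁴` (two Greek inputs,
Roman output) and `f⁻²` (two Roman inputs, Greek output). Mixed inputs count twice by antisymmetry.
-/
theorem sum_sq_scaled (c : κ ⊕ τ → κ ⊕ τ → κ ⊕ τ → ℝ) (hc : ∀ C A B, c C A B = -c C B A)
    {f : ℝ} (hf : f ≠ 0) :
    ∑ A, ∑ B, ∑ C, (frameScale f A * frameScale f B / frameScale f C) ^ 2 * (c C A B * c C A B) =
      (∑ i, ∑ j, ∑ k, c (inl k) (inl i) (inl j) * c (inl k) (inl i) (inl j))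
      + f ^ 2 * (∑ α, ∑ β, ∑ γ, c (inr γ) (inr α) (inr β) * c (inr γ) (inr α) (inr β))
      + f ^ 4 * (∑ i, ∑ γ, ∑ β, c (inl i) (inr γ) (inr β) * c (inl i) (inr γ) (inr β))
      + 2 * f ^ 2 * (∑ i, ∑ γ, ∑ j, c (inl i) (inr γ) (inl j) * c (inl i) (inr γ) (inl j))
      + 2 * (∑ α, ∑ k, ∑ β, c (inr α) (inl k) (inr β) * c (inr α) (inl k) (inr β))
      + (1 / f ^ 2) * (∑ α, ∑ k, ∑ j, c (inr α) (inl k) (inl j) * c (inr α) (inl k) (inl j)) := by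
  have h1 : ∑ γ, ∑ β, ∑ i, c (inl i) (inr γ) (inr β) * c (inl i) (inr γ) (inr β) =
      ∑ i, ∑ γ, ∑ β, c (inl i) (inr γ) (inr β) * c (inl i) (inr γ) (inr β) := by
    rw [Finset.sum_congr rfl fun γ _ => Finset.sum_comm, Finset.sum_comm]
  have h2 : ∑ γ, ∑ j, ∑ i, c (inl i) (inr γ) (inl j) * c (inl i) (inr γ) (inl j) =
      ∑ i, ∑ γ, ∑ j, c (inl i) (inr γ) (inl j) * c (inl i) (inr γ) (inl j) := by
    rw [Finset.sum_congr rfl fun γ _ => Finset.sum_comm, Finset.sum_comm]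
  have h2' : ∑ j, ∑ γ, ∑ i, c (inl i) (inl j) (inr γ) * c (inl i) (inl j) (inr γ) =
      ∑ i, ∑ γ, ∑ j, c (inl i) (inr γ) (inl j) * c (inl i) (inr γ) (inl j) := by
    rw [← h2, Finset.sum_comm]
    exact Finset.sum_congr rfl fun γ _ => Finset.sum_congr rfl fun j _ =>
      Finset.sum_congr rfl fun i _ => by rw [hc (inl i) (inl j) (inr γ)]; ring
  have h3 : ∑ k, ∑ β, ∑ α, c (inr α) (inl k) (inr β) * c (inr α) (inl k) (inr β) =
      ∑ α, ∑ k, ∑ β, c (inr α) (inl k) (inr β) * c (inr α) (inl k) (inr β) := by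
    rw [Finset.sum_congr rfl fun γ _ => Finset.sum_comm, Finset.sum_comm]
  have h3' : ∑ β, ∑ k, ∑ α, c (inr α) (inr β) (inl k) * c (inr α) (inr β) (inl k) =
      ∑ α, ∑ k, ∑ β, c (inr α) (inl k) (inr β) * c (inr α) (inl k) (inr β) := by
    rw [← h3, Finset.sum_comm]
    exact Finset.sum_congr rfl fun γ _ => Finset.sum_congr rfl fun j _ =>
      Finset.sum_congr rfl fun i _ => by rw [hc (inr i) (inr j) (inl γ)]; ring
  have h4 : ∑ k, ∑ j, ∑ α, c (inr α) (inl k) (inl j) * c (inr α) (inl k) (inl j) =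
      ∑ α, ∑ k, ∑ j, c (inr α) (inl k) (inl j) * c (inr α) (inl k) (inl j) := by
    rw [Finset.sum_congr rfl fun γ _ => Finset.sum_comm, Finset.sum_comm]
  simp only [Fintype.sum_sum_type, frameScale, Sum.elim_inl, Sum.elim_inr,
    Finset.sum_add_distrib, ← Finset.mul_sum, h1, h2, h2', h3, h3', h4]
  field_simp
  ring

/-- In the trace and Killing-type products the weights of `B` and `C` cancel and `λ_A²` is left; in
the squares they do not. -/
theorem structureQuadratic_scaled (c : κ ⊕ τ → κ ⊕ τ → κ ⊕ τ → ℝ) {f : ℝ} (hf : f ≠ 0) :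
    structureQuadratic
        (fun C A B => frameScale f A * frameScale f B / frameScale f C * c C A B) =
      -(∑ A, ∑ B, ∑ C, frameScale f A ^ 2 * (c B A B * c C A C))
      - (1 / 2) * (∑ A, ∑ B, ∑ C, frameScale f A ^ 2 * (c C A B * c B A C))
      - (1 / 4) * ∑ A, ∑ B, ∑ C,
        (frameScale f A * frameScale f B / frameScale f C) ^ 2 * (c C A B * c C A B) := by
  have hexp : ∀ A B C : κ ⊕ τ,
      frameScale f A * frameScale f B / frameScale f B * c B A B *
        (frameScale f A * frameScale f C / frameScale f C * c C A C)
      + 1 / 2 * (frameScale f A * frameScale f B / frameScale f C * c C A B *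
        (frameScale f A * frameScale f C / frameScale f B * c B A C))
      + 1 / 4 * (frameScale f A * frameScale f B / frameScale f C * c C A B *
        (frameScale f A * frameScale f B / frameScale f C * c C A B)) =
      frameScale f A ^ 2 * (c B A B * c C A C)
      + (1 / 2) * (frameScale f A ^ 2 * (c C A B * c B A C))
      + (1 / 4) * ((frameScale f A * frameScale f B / frameScale f C) ^ 2
        * (c C A B * c C A B)) := by
    intro A B C
    have hB := frameScale_ne_zero hf B
    have hC := frameScale_ne_zero hf C
    field_simp
  simp only [structureQuadratic, hexp, Finset.sum_add_distrib, ← Finset.mul_sum]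
  ring

end BlockDecomposition

/-! ### The expansion in powers of `f`, before involutivity is used. -/

section Manifold

open Sum

variable {n r s : ℕ} {M : Type*} [TopologicalSpace M] [ChartedSpace (EuclideanSpace ℝ (Fin n)) M]
  [RiemannianBundle (fun x : M => TangentSpace (𝓡 n) x)]

theorem frame_formula_scaled (e : Fin r ⊕ Fin s → ∀ x : M, TangentSpace (𝓡 n) x) (x : M) {f : ℝ}
    (hf : f ≠ 0) :
    2 * (∑ A, ∑ B, frameScale f A ^ 2 * dirDeriv (e A) (structureFn e B A B) x)
      + structureQuadratic (fun C A B =>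
        frameScale f A * frameScale f B / frameScale f C * structureFn e C A B x) =
      scalarX e x + f ^ 2 * scalarY e x + quadraticTerm e x * f ^ 2 + constantTerm e x
        + (1 / f ^ 2) * inverseQuadraticTerm e x + f ^ 4 * quarticTerm e x := by
  have hc : ∀ C A B, structureFn e C A B x = -structureFn e C B A x := fun C A B =>
    structureFn_antisymm e C A B x
  have hX : ∀ C A B, structureFn (fun i => e (inl i)) C A B x =
    structureFn e (inl C) (inl A) (inl B) x := fun _ _ _ => rfl
  have hY : ∀ C A B, structureFn (fun i => e (inr i)) C A B x =
    structureFn e (inr C) (inr A) (inr B) x := fun _ _ _ => rfl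
  have hX' : ∀ A B, structureFn (fun i => e (inl i)) B A B =
    structureFn e (inl B) (inl A) (inl B) := fun _ _ => rfl
  have hY' : ∀ A B, structureFn (fun i => e (inr i)) B A B =
    structureFn e (inr B) (inr A) (inr B) := fun _ _ => rfl
  have q1 := sum_trace_scaled (fun C A B => structureFn e C A B x) f
  have q2 := sum_killing_scaled (fun C A B => structureFn e C A B x) hc f
  have q3 := sum_sq_scaled (fun C A B => structureFn e C A B x) hc hf
  beta_reduce at q1 q2 q3
  rw [structureQuadratic_scaled _ hf, q1, q2, q3, scalarX, scalarY, blockScalarCurvature_eq,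
    blockScalarCurvature_eq]
  simp only [structureQuadratic, hX, hY, hX', hY', quadraticTerm, constantTerm,
    inverseQuadraticTerm, quarticTerm, Finset.sum_add_distrib, ← Finset.mul_sum,
    Fintype.sum_sum_type]
  simp only [frameScale, Sum.elim_inl, Sum.elim_inr, one_pow, one_mul, ← Finset.mul_sum,
    Finset.sum_add_distrib]
  ring

end Manifold

/-! ### Vector fields, brackets and metrics read in a chart. -/

section Charts

open scoped Topology

theorem sum_bilinear_single {n : ℕ} {T : Type*} [AddCommGroup T] [Module ℝ T] [TopologicalSpace T]
    [IsTopologicalAddGroup T] [ContinuousSMul ℝ T] (B : T →L[ℝ] T →L[ℝ] ℝ)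
    (D : EuclideanSpace ℝ (Fin n) →L[ℝ] T) (u v : EuclideanSpace ℝ (Fin n)) :
    ∑ i, ∑ j, u i * B (D (EuclideanSpace.single i 1)) (D (EuclideanSpace.single j 1)) * v j =
      B (D u) (D v) := by
  have hD : ∀ w, D w = ∑ i, w i • D (EuclideanSpace.single i 1) := fun w => by
    conv_lhs => rw [← (EuclideanSpace.basisFun (Fin n) ℝ).sum_repr w]
    simp
  rw [hD u, hD v]
  simp only [map_sum, map_smul, sum_apply, smul_apply, smul_eq_mul, Finset.mul_sum]
  rw [Finset.sum_comm]
  exact Finset.sum_congr rfl fun i _ => Finset.sum_congr rfl fun j _ => by ring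

variable {n : ℕ} {M : Type*} [TopologicalSpace M] [ChartedSpace (EuclideanSpace ℝ (Fin n)) M]

/-- The vector field `W` read in the preferred chart at `p`. -/
def fieldInChart (W : ∀ x : M, TangentSpace (𝓡 n) x) (p : M) (y : EuclideanSpace ℝ (Fin n)) :
    EuclideanSpace ℝ (Fin n) :=
  VectorField.mpullback 𝓘(ℝ, EuclideanSpace ℝ (Fin n)) (𝓡 n) (extChartAt (𝓡 n) p).symm W y

/-- The subset of `ℝⁿ` corresponding to `U` in the preferred chart at `p`. -/
def chartDomain (n : ℕ) {M : Type*} [TopologicalSpace M]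
    [ChartedSpace (EuclideanSpace ℝ (Fin n)) M] (U : Set M) (p : M) :
    Set (EuclideanSpace ℝ (Fin n)) :=
  (extChartAt (𝓡 n) p).target ∩ (extChartAt (𝓡 n) p).symm ⁻¹' U

theorem isOpen_chartDomain {U : Set M} (hU : IsOpen U) (p : M) : IsOpen (chartDomain n U p) :=
  (continuousOn_extChartAt_symm p).isOpen_inter_preimage (isOpen_extChartAt_target p) hU

theorem mem_chartDomain {U : Set M} {p : M} (hp : p ∈ U) :
    extChartAt (𝓡 n) p p ∈ chartDomain n U p :=
  ⟨mem_extChartAt_target p, by simpa using hp⟩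

variable [IsManifold (𝓡 n) ∞ M]

theorem isInvertible_mfderiv_symm {p : M} {y : EuclideanSpace ℝ (Fin n)}
    (hy : y ∈ (extChartAt (𝓡 n) p).target) :
    (mfderiv 𝓘(ℝ, EuclideanSpace ℝ (Fin n)) (𝓡 n) (extChartAt (𝓡 n) p).symm y).IsInvertible := by
  have := isInvertible_mfderivWithin_extChartAt_symm (I := 𝓡 n) hy
  rwa [ModelWithCorners.Boundaryless.range_eq_univ, mfderivWithin_univ] at this

theorem mfderiv_fieldInChart (W : ∀ x : M, TangentSpace (𝓡 n) x) {p : M}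
    {y : EuclideanSpace ℝ (Fin n)} (hy : y ∈ (extChartAt (𝓡 n) p).target) :
    mfderiv 𝓘(ℝ, EuclideanSpace ℝ (Fin n)) (𝓡 n) (extChartAt (𝓡 n) p).symm y
      (fieldInChart W p y) = W ((extChartAt (𝓡 n) p).symm y) := by
  rw [fieldInChart, VectorField.mpullback_apply]
  exact (isInvertible_mfderiv_symm hy).self_apply_inverse _

theorem mfderiv_smul_fieldInChart (a : ℝ) (W : ∀ x : M, TangentSpace (𝓡 n) x) {p : M}
    {y : EuclideanSpace ℝ (Fin n)} (hy : y ∈ (extChartAt (𝓡 n) p).target) :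
    mfderiv 𝓘(ℝ, EuclideanSpace ℝ (Fin n)) (𝓡 n) (extChartAt (𝓡 n) p).symm y
      (a • fieldInChart W p y : EuclideanSpace ℝ (Fin n)) =
        a • W ((extChartAt (𝓡 n) p).symm y) := by
  rw [← mfderiv_fieldInChart W hy]
  exact map_smul (mfderiv 𝓘(ℝ, EuclideanSpace ℝ (Fin n)) (𝓡 n) (extChartAt (𝓡 n) p).symm y) a _

theorem contMDiffAt_symm {p : M} {y : EuclideanSpace ℝ (Fin n)}
    (hy : y ∈ (extChartAt (𝓡 n) p).target) :
    ContMDiffAt 𝓘(ℝ, EuclideanSpace ℝ (Fin n)) (𝓡 n) ∞ (extChartAt (𝓡 n) p).symm y :=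
  (contMDiffOn_extChartAt_symm p).contMDiffAt ((isOpen_extChartAt_target p).mem_nhds hy)

theorem fieldInChart_contDiffOn {W : ∀ x : M, TangentSpace (𝓡 n) x} {U : Set M} (hU : IsOpen U)
    (hW : SmoothFieldOn W U) (p : M) : ContDiffOn ℝ ∞ (fieldInChart W p) (chartDomain n U p) := by
  intro y hy
  have h1 : ContMDiffAt 𝓘(ℝ, EuclideanSpace ℝ (Fin n)) (𝓡 n).tangent ∞
      (fun z => (⟨z, fieldInChart W p z⟩ :
        TangentBundle 𝓘(ℝ, EuclideanSpace ℝ (Fin n)) (EuclideanSpace ℝ (Fin n)))) y :=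
    ContMDiffAt.mpullback_vectorField_preimage (n := ∞) (hW.contMDiffAt (hU.mem_nhds hy.2))
      (contMDiffAt_symm hy.1) (isInvertible_mfderiv_symm hy.1) (by simp)
  exact ((contMDiffAt_vectorSpace_iff_contDiffAt).1 h1).contDiffWithinAt

theorem lieBracket_fieldInChart {W W' : ∀ x : M, TangentSpace (𝓡 n) x} {U : Set M} (hU : IsOpen U)
    (hW : SmoothFieldOn W U) (hW' : SmoothFieldOn W' U) {p : M} {y : EuclideanSpace ℝ (Fin n)}
    (hy : y ∈ chartDomain n U p) :
    VectorField.lieBracket ℝ (fieldInChart W p) (fieldInChart W' p) y =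
      fieldInChart (VectorField.mlieBracket (𝓡 n) W W') p y := by
  have h2 : minSmoothness ℝ 2 ≤ ∞ := by simpa using ENat.LEInfty.out
  have : IsManifold (𝓡 n) (minSmoothness ℝ 2) M := IsManifold.of_le h2
  have h1 := VectorField.mpullback_mlieBracket (n := ∞)
    ((hW.contMDiffAt (hU.mem_nhds hy.2)).mdifferentiableAt (by simp))
    ((hW'.contMDiffAt (hU.mem_nhds hy.2)).mdifferentiableAt (by simp))
    (contMDiffAt_symm hy.1) h2
  rw [fieldInChart, h1, ← VectorField.mlieBracketWithin_univ,
    VectorField.mlieBracketWithin_eq_lieBracketWithin]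
  exact congrFun VectorField.lieBracketWithin_univ.symm y

omit [IsManifold (𝓡 n) ∞ M] in
theorem gramInChart_apply (h : ∀ x : M, TangentSpace (𝓡 n) x →L[ℝ] TangentSpace (𝓡 n) x →L[ℝ] ℝ)
    (p : M) (y u v : EuclideanSpace ℝ (Fin n)) :
    ∑ i, ∑ j, u i * gramInChart h p y i j * v j =
      h ((extChartAt (𝓡 n) p).symm y)
        (mfderiv 𝓘(ℝ, EuclideanSpace ℝ (Fin n)) (𝓡 n) (extChartAt (𝓡 n) p).symm y u)
        (mfderiv 𝓘(ℝ, EuclideanSpace ℝ (Fin n)) (𝓡 n) (extChartAt (𝓡 n) p).symm y v) := by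
  exact sum_bilinear_single (T := TangentSpace (𝓡 n) ((extChartAt (𝓡 n) p).symm y))
    (h ((extChartAt (𝓡 n) p).symm y))
    (mfderiv 𝓘(ℝ, EuclideanSpace ℝ (Fin n)) (𝓡 n) (extChartAt (𝓡 n) p).symm y) u v

theorem fderiv_comp_symm {F : M → ℝ} {U : Set M} (hU : IsOpen U) {p : M}
    (hF : ContDiffOn ℝ ∞ (fun z => F ((extChartAt (𝓡 n) p).symm z)) (chartDomain n U p))
    (W : ∀ x : M, TangentSpace (𝓡 n) x) {y : EuclideanSpace ℝ (Fin n)}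
    (hy : y ∈ chartDomain n U p) :
    fderiv ℝ (fun z => F ((extChartAt (𝓡 n) p).symm z)) y (fieldInChart W p y) =
      dirDeriv W F ((extChartAt (𝓡 n) p).symm y) := by
  have hx : (extChartAt (𝓡 n) p).symm y ∈ (extChartAt (𝓡 n) p).source :=
    (extChartAt (𝓡 n) p).map_target hy.1
  have hFy : DifferentiableAt ℝ (fun z => F ((extChartAt (𝓡 n) p).symm z)) y :=
    differentiableAt_of_contDiffOn (isOpen_chartDomain hU p) hF hy
  -- Differentiability of `F` on the manifold is recovered by composing its coordinate expression
  -- with the chart, which gives back `F` near the point.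
  have hd : MDifferentiableAt (𝓡 n) 𝓘(ℝ, ℝ) F ((extChartAt (𝓡 n) p).symm y) := by
    have h1 : MDifferentiableAt (𝓡 n) 𝓘(ℝ, ℝ)
        ((fun z => F ((extChartAt (𝓡 n) p).symm z)) ∘ extChartAt (𝓡 n) p)
        ((extChartAt (𝓡 n) p).symm y) := by
      refine MDifferentiableAt.comp _ ?_ (mdifferentiableAt_extChartAt (by simpa using hx))
      rw [(extChartAt (𝓡 n) p).right_inv hy.1]
      exact hFy.mdifferentiableAt
    refine h1.congr_of_eventuallyEq ?_
    filter_upwards [(isOpen_extChartAt_source p).mem_nhds hx] with z hz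
    rw [Function.comp_apply, (extChartAt (𝓡 n) p).left_inv hz]
  have h2 := mfderiv_comp y hd ((contMDiffAt_symm hy.1).mdifferentiableAt (by simp))
  rw [mfderiv_eq_fderiv] at h2
  rw [dirDeriv, ← mfderiv_fieldInChart W hy.1]
  exact congrArg (fun L => L (fieldInChart W p y)) h2

end Charts

/-! ### Adapted frames and the scalar curvature formula for the collapsed metric. -/

section AdaptedFrames

open scoped Topology

variable {n r s : ℕ} {M : Type*} [TopologicalSpace M]
  [ChartedSpace (EuclideanSpace ℝ (Fin n)) M] [IsManifold (𝓡 n) ∞ M]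
  [RiemannianBundle (fun x : M => TangentSpace (𝓡 n) x)]
  {Y : ∀ x : M, Submodule ℝ (TangentSpace (𝓡 n) x)} {U : Set M}
  {e : Fin r ⊕ Fin s → ∀ x : M, TangentSpace (𝓡 n) x}

namespace IsAdaptedFrame

theorem inl_mem (he : IsAdaptedFrame Y U e) {x : M} (hx : x ∈ U) (i : Fin r) :
    e (Sum.inl i) x ∈ (Y x)ᗮ := by
  rw [← he.span_X x hx]; exact Submodule.subset_span ⟨i, rfl⟩

theorem inr_mem (he : IsAdaptedFrame Y U e) {x : M} (hx : x ∈ U) (α : Fin s) :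
    e (Sum.inr α) x ∈ Y x := by
  rw [← he.span_Y x hx]; exact Submodule.subset_span ⟨α, rfl⟩

theorem collapsedMetric_scaled (he : IsAdaptedFrame Y U e) {x : M} (hx : x ∈ U) {f : ℝ}
    (hf : f ≠ 0) (A B : Fin r ⊕ Fin s) :
    collapsedMetric Y f x (frameScale f A • e A x) (frameScale f B • e B x) =
      if A = B then 1 else 0 := by
  have ho := fun A B => orthonormal_iff_ite.1 (he.orthonormal x hx) A B
  have hXX : ∀ i, (Y x)ᗮ.starProjection (e (Sum.inl i) x) = e (Sum.inl i) x := fun i =>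
    Submodule.starProjection_eq_self_iff.2 (he.inl_mem hx i)
  have hYY : ∀ α, (Y x).starProjection (e (Sum.inr α) x) = e (Sum.inr α) x := fun α =>
    Submodule.starProjection_eq_self_iff.2 (he.inr_mem hx α)
  have hXY : ∀ α, (Y x)ᗮ.starProjection (e (Sum.inr α) x) = 0 := fun α =>
    Submodule.starProjection_orthogonal_apply_eq_zero (he.inr_mem hx α)
  have hYX : ∀ i, (Y x).starProjection (e (Sum.inl i) x) = 0 := fun i => by
    have := (Y x).starProjection_add_starProjection_orthogonal (e (Sum.inl i) x)
    rwa [hXX, add_eq_right] at this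
  have hexp : ∀ v w : TangentSpace (𝓡 n) x, collapsedMetric Y f x v w =
      inner ℝ ((Y x)ᗮ.starProjection v) ((Y x)ᗮ.starProjection w)
        + (f ^ 2)⁻¹ * inner ℝ ((Y x).starProjection v) ((Y x).starProjection w) :=
    fun v w => rfl
  rw [hexp]
  rcases A with i | α <;> rcases B with j | β <;>
    simp [frameScale, hXX, hYY, hXY, hYX, inner_smul_left, inner_smul_right, ho]
  field_simp

theorem sum_inner_smul (hn : r + s = n) (he : IsAdaptedFrame Y U e) {x : M} (hx : x ∈ U)
    (v : TangentSpace (𝓡 n) x) : v = ∑ A, inner ℝ v (e A x) • e A x := by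
  have hfr : Fintype.card (Fin r ⊕ Fin s) = Module.finrank ℝ (TangentSpace (𝓡 n) x) := by
    have : Module.finrank ℝ (TangentSpace (𝓡 n) x) = n :=
      finrank_euclideanSpace_fin (𝕜 := ℝ) (n := n)
    simp [this, hn]
  have ho := he.orthonormal x hx
  have hspan := ho.linearIndependent.span_eq_top_of_card_eq_finrank' hfr
  have h2 := (OrthonormalBasis.mk ho hspan.ge).sum_repr' v
  conv_lhs => rw [← h2]
  simp [real_inner_comm]

/-- The bridge from the manifold to the coordinate theory: pullback by the chart respects brackets,
and the constant weights factor out of them. -/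
theorem isCoordFrame (hn : r + s = n) (he : IsAdaptedFrame Y U e) {f : ℝ} (hf : f ≠ 0) (p : M) :
    IsCoordFrame (chartDomain n U p) (gramInChart (collapsedMetric Y f) p)
      (fun A y => frameScale f A • fieldInChart (e A) p y)
      (fun C A B y => frameScale f A * frameScale f B / frameScale f C *
        structureFn e C A B ((extChartAt (𝓡 n) p).symm y)) where
  isOpen := isOpen_chartDomain he.isOpen p
  card := by simp [hn]
  smooth A := (fieldInChart_contDiffOn he.isOpen (he.smooth A) p).const_smul _
  orthonormal y hy A B := by
    rw [gramInChart_apply, ← he.collapsedMetric_scaled hy.2 hf A B,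
      mfderiv_smul_fieldInChart _ _ hy.1, mfderiv_smul_fieldInChart _ _ hy.1]
  bracket y hy A B := by
    have hd : ∀ A, DifferentiableAt ℝ (fieldInChart (e A) p) y := fun A =>
      ((fieldInChart_contDiffOn he.isOpen (he.smooth A) p).differentiableOn (by simp) y
        hy).differentiableAt ((isOpen_chartDomain he.isOpen p).mem_nhds hy)
    have h1 : VectorField.lieBracket ℝ (fieldInChart (e A) p) (fieldInChart (e B) p) y =
        ∑ C, structureFn e C A B ((extChartAt (𝓡 n) p).symm y) • fieldInChart (e C) p y := by
      rw [lieBracket_fieldInChart he.isOpen (he.smooth A) (he.smooth B) hy, fieldInChart,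
        VectorField.mpullback_apply, he.sum_inner_smul hn hy.2 (VectorField.mlieBracket _ _ _ _)]
      simp only [map_sum, map_smul]
      rfl
    have h2 := VectorField.lieBracket_const_smul_left (c := frameScale f A)
      (W := frameScale f B • fieldInChart (e B) p) (hd A)
    have h3 := VectorField.lieBracket_const_smul_right (c := frameScale f B)
      (V := fieldInChart (e A) p) (hd B)
    refine h2.trans ?_
    rw [h3, h1]
    simp only [Finset.smul_sum, smul_smul]
    refine Finset.sum_congr rfl fun C _ => ?_
    have := frameScale_ne_zero hf C
    congr 1
    field_simp
  antisymm C A B y := by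
    rw [structureFn_antisymm e C A B]; ring

theorem structureFn_contDiffOn (hn : r + s = n) (he : IsAdaptedFrame Y U e) (p : M)
    (C A B : Fin r ⊕ Fin s) :
    ContDiffOn ℝ ∞ (fun y => structureFn e C A B ((extChartAt (𝓡 n) p).symm y))
      (chartDomain n U p) := by
  -- At `f = 1` all weights are trivial, so the smoothness of the rescaled structure functions is
  -- that of the original ones.
  have h1 : ∀ A : Fin r ⊕ Fin s, frameScale 1 A = 1 := by rintro (i | i) <;> rfl
  simpa [h1] using (he.isCoordFrame hn one_ne_zero p).structure_contDiffOn C A B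

theorem structureFn_inl_inr_inr (hinv : IsInvolutive Y) (he : IsAdaptedFrame Y U e) {x : M}
    (hx : x ∈ U) : ∀ i γ β, structureFn e (Sum.inl i) (Sum.inr γ) (Sum.inr β) x = 0 := by
  intro i γ β
  refine Submodule.inner_right_of_mem_orthogonal ?_ (he.inl_mem hx i)
  exact hinv U _ _ he.isOpen (he.smooth _) (he.smooth _) (fun x hx => he.inr_mem hx γ)
    (fun x hx => he.inr_mem hx β) x hx

theorem scalarCurvature_collapsedMetric (hn : r + s = n) (hinv : IsInvolutive Y)
    (he : IsAdaptedFrame Y U e) {x : M} (hx : x ∈ U) {f : ℝ} (hf : f ≠ 0) :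
    scalarCurvature (collapsedMetric Y f) x =
      scalarX e x + f ^ 2 * scalarY e x + quadraticTerm e x * f ^ 2 + constantTerm e x
        + (1 / f ^ 2) * inverseQuadraticTerm e x := by
  have hq : quarticTerm e x = 0 := by
    simp [quarticTerm, he.structureFn_inl_inr_inr hinv hx]
  have hy := mem_chartDomain (n := n) hx
  have hsymm : (extChartAt (𝓡 n) x).symm (extChartAt (𝓡 n) x x) = x := extChartAt_to_inv x
  rw [scalarCurvature, (he.isCoordFrame hn hf x).coordScalarCurvature_eq hy]
  have := frame_formula_scaled e x hf
  rw [hq, mul_zero, add_zero] at this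
  rw [← this]
  simp only [hsymm]
  congr 2
  refine Finset.sum_congr rfl fun A _ => Finset.sum_congr rfl fun B _ => ?_
  have h1 := fderiv_comp_symm he.isOpen (he.structureFn_contDiffOn hn x B A B) (e A) hy
  rw [hsymm] at h1
  rw [fderiv_const_mul (differentiableAt_of_contDiffOn (isOpen_chartDomain he.isOpen x)
    (he.structureFn_contDiffOn hn x B A B) hy), map_smul, ← h1, smul_apply, smul_eq_mul, smul_eq_mul]
  have := frameScale_ne_zero hf B
  field_simp

end IsAdaptedFrame

end AdaptedFrames

/-! ### A smoothness criterion for fields of bilinear forms. -/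

section SmoothBilinearForms

open scoped Topology

variable {n : ℕ} {M : Type*} [TopologicalSpace M]
  [ChartedSpace (EuclideanSpace ℝ (Fin n)) M] [IsManifold (𝓡 n) ∞ M]

/-- The vector field with constant coordinates `v` in the preferred trivialization at `p`. -/
def constantField (p : M) (v : EuclideanSpace ℝ (Fin n)) (x : M) : TangentSpace (𝓡 n) x :=
  (trivializationAt (EuclideanSpace ℝ (Fin n)) (TangentSpace (𝓡 n)) p).symm x v

theorem contMDiffAt_constantField (p : M) (v : EuclideanSpace ℝ (Fin n)) :
    ContMDiffAt (𝓡 n) (𝓡 n).tangent ∞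
      (fun x => (⟨x, constantField p v x⟩ : TangentBundle (𝓡 n) M)) p := by
  set t := trivializationAt (EuclideanSpace ℝ (Fin n)) (TangentSpace (𝓡 n) (M := M)) p
  have hp : p ∈ t.baseSet := FiberBundle.mem_baseSet_trivializationAt' p
  have h1 : ContMDiffAt ((𝓡 n).prod 𝓘(ℝ, EuclideanSpace ℝ (Fin n))) (𝓡 n).tangent ∞
      t.toOpenPartialHomeomorph.symm (p, v) :=
    (t.contMDiffOn_symm (n := ∞) (IB := 𝓡 n)).contMDiffAt
      (t.open_target.mem_nhds (by rw [t.mem_target]; exact hp))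
  have h2 : ContMDiffAt (𝓡 n) ((𝓡 n).prod 𝓘(ℝ, EuclideanSpace ℝ (Fin n))) ∞
      (fun x : M => (x, v)) p := contMDiffAt_id.prodMk contMDiffAt_const
  refine (h1.comp p h2).congr_of_eventuallyEq ?_
  filter_upwards [t.open_baseSet.mem_nhds hp] with x hx
  exact t.mk_symm hx v

/-- In the trivialization at `p` the form is a finite combination of fixed bilinear forms, whose
coefficients are its values on the fields with constant coordinates `single i 1`. -/
theorem contMDiffAt_bilinear_of_constantField
    (h : ∀ x : M, TangentSpace (𝓡 n) x →L[ℝ] TangentSpace (𝓡 n) x →L[ℝ] ℝ) (p : M)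
    (hs : ∀ v w, ContMDiffAt (𝓡 n) 𝓘(ℝ, ℝ) ∞
      (fun x => h x (constantField p v x) (constantField p w x)) p) :
    ContMDiffAt (𝓡 n)
      ((𝓡 n).prod 𝓘(ℝ, EuclideanSpace ℝ (Fin n) →L[ℝ] EuclideanSpace ℝ (Fin n) →L[ℝ] ℝ)) ∞
      (fun x => TotalSpace.mk'
        (EuclideanSpace ℝ (Fin n) →L[ℝ] EuclideanSpace ℝ (Fin n) →L[ℝ] ℝ)
        (E := fun x : M => TangentSpace (𝓡 n) x →L[ℝ] TangentSpace (𝓡 n) x →L[ℝ] ℝ) x (h x)) p := by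
  rw [contMDiffAt_hom_bundle]
  refine ⟨contMDiffAt_id, ?_⟩
  let P : Fin n → EuclideanSpace ℝ (Fin n) →L[ℝ] ℝ := fun i => EuclideanSpace.proj i
  have hP : ∀ i u, P i u = u i := fun _ _ => rfl
  have hsum : ContMDiffAt (𝓡 n)
      𝓘(ℝ, EuclideanSpace ℝ (Fin n) →L[ℝ] EuclideanSpace ℝ (Fin n) →L[ℝ] ℝ) ∞
      (fun x => ∑ i, ∑ j, h x (constantField p (EuclideanSpace.single i 1) x)
        (constantField p (EuclideanSpace.single j 1) x) • (P i).smulRight (P j)) p :=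
    contMDiffAt_finsetSum fun i _ => contMDiffAt_finsetSum fun j _ =>
      (hs _ _).smul contMDiffAt_const
  refine hsum.congr_of_eventuallyEq ?_
  set t := trivializationAt (EuclideanSpace ℝ (Fin n)) (TangentSpace (𝓡 n) (M := M)) p
  have hp : p ∈ t.baseSet := FiberBundle.mem_baseSet_trivializationAt' p
  filter_upwards [t.open_baseSet.mem_nhds hp] with x hx
  have hL : ∀ v w, ContinuousLinearMap.inCoordinates (EuclideanSpace ℝ (Fin n))
      (fun x : M => TangentSpace (𝓡 n) x) (EuclideanSpace ℝ (Fin n) →L[ℝ] ℝ)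
      (fun x : M => TangentSpace (𝓡 n) x →L[ℝ] ℝ) p x p x (h x) v w =
      h x (constantField p v x) (constantField p w x) := by
    intro v w
    have := inCoordinates_apply_eq₂ (𝕜 := ℝ) (F₁ := EuclideanSpace ℝ (Fin n))
      (F₂ := EuclideanSpace ℝ (Fin n)) (F₃ := ℝ) (E₁ := fun x : M => TangentSpace (𝓡 n) x)
      (E₂ := fun x : M => TangentSpace (𝓡 n) x) (E₃ := fun _ : M => ℝ) (x₀ := p) (x := x)
      (ϕ := h x) (v := v) (w := w) hx hx (Set.mem_univ _)
    refine this.trans ?_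
    simp
    rfl
  ext v w
  refine (sum_bilinear_single (ContinuousLinearMap.inCoordinates (EuclideanSpace ℝ (Fin n))
      (fun x : M => TangentSpace (𝓡 n) x) (EuclideanSpace ℝ (Fin n) →L[ℝ] ℝ)
      (fun x : M => TangentSpace (𝓡 n) x →L[ℝ] ℝ) p x p x (h x))
      (ContinuousLinearMap.id ℝ _) v w).symm.trans ?_
  simp only [ContinuousLinearMap.id_apply, hL, sum_apply, smul_apply,
    ContinuousLinearMap.smulRight_apply, smul_eq_mul, hP]
  exact Finset.sum_congr rfl fun i _ => Finset.sum_congr rfl fun j _ => by ring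

end SmoothBilinearForms

/-! ### The collapsed form is a smooth Riemannian metric. -/

section CollapsedMetric

open scoped Topology

variable {n r s : ℕ} {M : Type*} [TopologicalSpace M]
  [ChartedSpace (EuclideanSpace ℝ (Fin n)) M] [IsManifold (𝓡 n) ∞ M]
  [RiemannianBundle (fun x : M => TangentSpace (𝓡 n) x)]
  {Y : ∀ x : M, Submodule ℝ (TangentSpace (𝓡 n) x)} {U : Set M}
  {e : Fin r ⊕ Fin s → ∀ x : M, TangentSpace (𝓡 n) x}

namespace IsAdaptedFrame

theorem collapsedMetric_apply (hn : r + s = n) (he : IsAdaptedFrame Y U e) {x : M} (hx : x ∈ U)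
    {f : ℝ} (hf : f ≠ 0) (v w : TangentSpace (𝓡 n) x) :
    collapsedMetric Y f x v w =
      ∑ A, (frameScale f A ^ 2)⁻¹ * (inner ℝ v (e A x) * inner ℝ w (e A x)) := by
  have hAB : ∀ A B, collapsedMetric Y f x (e A x) (e B x) =
      if A = B then (frameScale f A ^ 2)⁻¹ else 0 := by
    intro A B
    have h1 := he.collapsedMetric_scaled hx hf A B
    have hA := frameScale_ne_zero hf A
    have hB := frameScale_ne_zero hf B
    simp only [map_smul, smul_apply, smul_eq_mul] at h1
    split_ifs with h
    · subst h
      rw [if_pos rfl] at h1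
      field_simp
      linarith
    · rw [if_neg h] at h1
      simpa [hA, hB] using h1
  conv_lhs => rw [he.sum_inner_smul hn hx v, he.sum_inner_smul hn hx w]
  simp only [map_sum, map_smul, sum_apply, smul_apply, smul_eq_mul, hAB, mul_ite,
    mul_zero, Finset.sum_ite_eq', Finset.mem_univ, if_true]
  exact Finset.sum_congr rfl fun A _ => by ring

/-- Both forms are diagonal in the frame, and `1 + f²` dominates both squared weights `1` and `f²`.
This one bound gives positive definiteness and boundedness of the unit balls. -/
theorem inner_le_collapsedMetric (hn : r + s = n) (he : IsAdaptedFrame Y U e) {x : M} (hx : x ∈ U)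
    {f : ℝ} (hf : f ≠ 0) (v : TangentSpace (𝓡 n) x) :
    inner ℝ v v ≤ (1 + f ^ 2) * collapsedMetric Y f x v v := by
  have h1 : (inner ℝ v v : ℝ) = ∑ A, inner ℝ v (e A x) * inner ℝ v (e A x) := by
    conv_lhs => rw [he.sum_inner_smul hn hx v, sum_inner]
    refine Finset.sum_congr rfl fun A _ => ?_
    rw [← he.sum_inner_smul hn hx v, inner_smul_left, real_inner_comm]
    simp
  rw [h1, he.collapsedMetric_apply hn hx hf, Finset.mul_sum]
  refine Finset.sum_le_sum fun A _ => ?_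
  have h2 : 1 ≤ (1 + f ^ 2) * (frameScale f A ^ 2)⁻¹ := by
    have hf2 : 0 < f ^ 2 := by positivity
    rcases A with i | α
    · simp [frameScale]; positivity
    · change 1 ≤ (1 + f ^ 2) * (f ^ 2)⁻¹
      rw [← div_eq_mul_inv, one_le_div hf2]
      linarith
  nlinarith [mul_self_nonneg (inner ℝ v (e A x) : ℝ)]

end IsAdaptedFrame

omit [IsManifold (𝓡 n) ∞ M] in
theorem collapsedMetric_symm (Y : ∀ x : M, Submodule ℝ (TangentSpace (𝓡 n) x)) (f : ℝ) (x : M)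
    (v w : TangentSpace (𝓡 n) x) : collapsedMetric Y f x v w = collapsedMetric Y f x w v := by
  change inner ℝ ((Y x)ᗮ.starProjection v) ((Y x)ᗮ.starProjection w)
        + (f ^ 2)⁻¹ * inner ℝ ((Y x).starProjection v) ((Y x).starProjection w) =
      inner ℝ ((Y x)ᗮ.starProjection w) ((Y x)ᗮ.starProjection v)
        + (f ^ 2)⁻¹ * inner ℝ ((Y x).starProjection w) ((Y x).starProjection v)
  rw [real_inner_comm, real_inner_comm ((Y x).starProjection v)]

theorem exists_contMDiffRiemannianMetric [IsContMDiffRiemannianBundle (𝓡 n) ∞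
    (EuclideanSpace ℝ (Fin n)) (fun x : M => TangentSpace (𝓡 n) x)] (hn : r + s = n)
    (hframe : ∀ p : M, ∃ (U : Set M) (e : Fin r ⊕ Fin s → ∀ x : M, TangentSpace (𝓡 n) x),
      p ∈ U ∧ IsAdaptedFrame Y U e) {f : ℝ} (hf : f ≠ 0) :
    ∃ g' : ContMDiffRiemannianMetric (𝓡 n) ∞ (EuclideanSpace ℝ (Fin n))
      (fun x : M => TangentSpace (𝓡 n) x), ∀ x, g'.inner x = collapsedMetric Y f x := by
  have hle : ∀ (x : M) (v : TangentSpace (𝓡 n) x),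
      inner ℝ v v ≤ (1 + f ^ 2) * collapsedMetric Y f x v v := fun x v => by
    obtain ⟨U, e, hx, he⟩ := hframe x
    exact he.inner_le_collapsedMetric hn hx hf v
  have hf1 : 0 < 1 + f ^ 2 := by positivity
  refine ⟨{ inner := collapsedMetric Y f, symm := collapsedMetric_symm Y f, pos := ?_,
            isVonNBounded := ?_, contMDiff := ?_ }, fun x => rfl⟩
  · intro x v hv
    have h1 : (0 : ℝ) < inner ℝ v v := real_inner_self_pos.2 hv
    exact (mul_pos_iff_of_pos_left hf1).1 (h1.trans_le (hle x v))
  · intro x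
    -- The bound gives `‖v‖² ≤ 1 + f² ≤ (1 + f²)²`, so this crude radius suffices and no square root
    -- is needed.
    refine (NormedSpace.isVonNBounded_closedBall ℝ (TangentSpace (𝓡 n) x) (1 + f ^ 2)).subset ?_
    intro v hv
    have hv' : collapsedMetric Y f x v v < 1 := hv
    have h1 := hle x v
    rw [real_inner_self_eq_norm_sq] at h1
    rw [mem_closedBall_zero_iff]
    nlinarith [norm_nonneg v, sq_nonneg f]
  · intro p
    obtain ⟨U, e, hp, he⟩ := hframe p
    refine contMDiffAt_bilinear_of_constantField _ p fun v w => ?_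
    have hA : ∀ A, ContMDiffAt (𝓡 n) (𝓡 n).tangent ∞
        (fun x => (⟨x, e A x⟩ : TangentBundle (𝓡 n) M)) p := fun A =>
      (he.smooth A).contMDiffAt (he.isOpen.mem_nhds hp)
    have hi : ∀ A u, ContMDiffAt (𝓡 n) 𝓘(ℝ, ℝ) ∞
        (fun x => inner ℝ (constantField p u x) (e A x)) p := fun A u =>
      (contMDiffAt_constantField p u).inner_bundle (hA A)
    refine ContMDiffAt.congr_of_eventuallyEq (f := fun x => ∑ A, (frameScale f A ^ 2)⁻¹ *
      (inner ℝ (constantField p v x) (e A x) * inner ℝ (constantField p w x) (e A x)))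
      (contMDiffAt_finsetSum fun A _ => contMDiffAt_const.mul ((hi A v).mul (hi A w))) ?_
    filter_upwards [he.isOpen.mem_nhds hp] with x hx
    exact he.collapsedMetric_apply hn hx hf _ _

end CollapsedMetric

/-! ### Positivity for large `f`: continuity, local bounds, compactness. -/

section Positivity

open scoped Topology

variable {n r s : ℕ} {M : Type*} [TopologicalSpace M]
  [ChartedSpace (EuclideanSpace ℝ (Fin n)) M] [IsManifold (𝓡 n) ∞ M]
  [RiemannianBundle (fun x : M => TangentSpace (𝓡 n) x)]
  {Y : ∀ x : M, Submodule ℝ (TangentSpace (𝓡 n) x)} {U : Set M}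
  {e : Fin r ⊕ Fin s → ∀ x : M, TangentSpace (𝓡 n) x}

omit [IsManifold (𝓡 n) ∞ M] [RiemannianBundle (fun x : M => TangentSpace (𝓡 n) x)] in
theorem continuousAt_of_continuousOn_chart (hU : IsOpen U) {p : M} (hp : p ∈ U) {F : M → ℝ}
    {g : EuclideanSpace ℝ (Fin n) → ℝ} (hg : ContinuousOn g (chartDomain n U p))
    (h : ∀ y ∈ chartDomain n U p, g y = F ((extChartAt (𝓡 n) p).symm y)) : ContinuousAt F p := by
  have h1 : ContinuousAt (g ∘ extChartAt (𝓡 n) p) p :=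
    (hg.continuousAt ((isOpen_chartDomain hU p).mem_nhds (mem_chartDomain hp))).comp
      (continuousAt_extChartAt p)
  refine h1.congr_of_eventuallyEq ?_
  filter_upwards [(isOpen_extChartAt_source p).mem_nhds (mem_extChartAt_source (I := 𝓡 n) p),
    hU.mem_nhds hp] with x hx hxU
  have hinv := (extChartAt (𝓡 n) p).left_inv hx
  rw [Function.comp_apply, h _ ⟨(extChartAt (𝓡 n) p).map_source hx, by rwa [Set.mem_preimage, hinv]⟩,
    hinv]

namespace IsAdaptedFrame

theorem continuousAt_structureFn (hn : r + s = n) (he : IsAdaptedFrame Y U e) {p : M} (hp : p ∈ U)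
    (C A B : Fin r ⊕ Fin s) : ContinuousAt (fun x => structureFn e C A B x) p :=
  continuousAt_of_continuousOn_chart he.isOpen hp
    (he.structureFn_contDiffOn hn p C A B).continuousOn fun _ _ => rfl

theorem continuousAt_dirDeriv (hn : r + s = n) (he : IsAdaptedFrame Y U e) {p : M} (hp : p ∈ U)
    (C A B D : Fin r ⊕ Fin s) :
    ContinuousAt (fun x => dirDeriv (e D) (structureFn e C A B) x) p :=
  continuousAt_of_continuousOn_chart he.isOpen hp
    ((((he.structureFn_contDiffOn hn p C A B).fderiv_of_isOpen (isOpen_chartDomain he.isOpen p)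
      (m := ∞) (by simp)).clm_apply
        (fieldInChart_contDiffOn he.isOpen (he.smooth D) p)).continuousOn)
    fun _ hy => fderiv_comp_symm he.isOpen (he.structureFn_contDiffOn hn p C A B) (e D) hy

theorem continuousAt_blockScalarCurvature (hn : r + s = n) (he : IsAdaptedFrame Y U e) {p : M}
    (hp : p ∈ U) {κ : Type*} [Fintype κ] (i : κ → Fin r ⊕ Fin s) :
    ContinuousAt (blockScalarCurvature fun a => e (i a)) p := by
  have hc := he.continuousAt_structureFn hn hp
  have hd := he.continuousAt_dirDeriv hn hp
  have h1 : blockScalarCurvature (fun a => e (i a)) = fun x =>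
      2 * ∑ a, ∑ b, dirDeriv (e (i a)) (structureFn e (i b) (i a) (i b)) x
        + structureQuadratic fun c a b => structureFn e (i c) (i a) (i b) x :=
    funext fun x => blockScalarCurvature_eq _ x
  rw [h1]
  unfold structureQuadratic
  fun_prop

theorem continuousAt_npbExpr (hn : r + s = n) (he : IsAdaptedFrame Y U e) {p : M} (hp : p ∈ U) :
    ContinuousAt (npbExpr e) p := by
  have hc := he.continuousAt_structureFn hn hp
  have hd := he.continuousAt_dirDeriv hn hp
  have hY : ContinuousAt (fun x => scalarY e x) p :=
    he.continuousAt_blockScalarCurvature hn hp Sum.inr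
  unfold npbExpr
  fun_prop

theorem continuousAt_constantTerm (hn : r + s = n) (he : IsAdaptedFrame Y U e) {p : M}
    (hp : p ∈ U) : ContinuousAt (constantTerm e) p := by
  have hc := he.continuousAt_structureFn hn hp
  have hd := he.continuousAt_dirDeriv hn hp
  unfold constantTerm
  fun_prop

theorem continuousAt_inverseQuadraticTerm (hn : r + s = n) (he : IsAdaptedFrame Y U e) {p : M}
    (hp : p ∈ U) : ContinuousAt (inverseQuadraticTerm e) p := by
  have hc := he.continuousAt_structureFn hn hp
  unfold inverseQuadraticTerm
  fun_prop

/-- The term `c^i_{γβ} c^γ_{iβ}`, absent from `npbExpr`, is zero by involutivity. -/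
theorem scalarCurvature_eq_npbExpr (hn : r + s = n) (hinv : IsInvolutive Y)
    (he : IsAdaptedFrame Y U e) {x : M} (hx : x ∈ U) {f : ℝ} (hf : f ≠ 0) :
    scalarCurvature (collapsedMetric Y f) x =
      f ^ 2 * npbExpr e x + (scalarX e x + constantTerm e x)
        + (1 / f ^ 2) * inverseQuadraticTerm e x := by
  have h1 : npbExpr e x = scalarY e x + quadraticTerm e x := by
    simp only [npbExpr, quadraticTerm, he.structureFn_inl_inr_inr hinv hx, zero_mul,
      Finset.sum_const_zero]
    ring
  rw [he.scalarCurvature_collapsedMetric hn hinv hx hf, h1]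
  ring

theorem eventually_scalarCurvature_pos (hn : r + s = n) (hinv : IsInvolutive Y)
    (he : IsAdaptedFrame Y U e) {p : M} (hp : p ∈ U) (hpos : 0 < npbExpr e p) :
    ∃ f₀ : ℝ, 0 < f₀ ∧ ∀ᶠ x in 𝓝 p, ∀ f : ℝ, f₀ ≤ f →
      0 < scalarCurvature (collapsedMetric Y f) x := by
  have hX : ContinuousAt (fun x => scalarX e x + constantTerm e x) p :=
    (he.continuousAt_blockScalarCurvature hn hp Sum.inl).add (he.continuousAt_constantTerm hn hp)
  set ε := npbExpr e p / 2
  set b := scalarX e p + constantTerm e p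
  set d := inverseQuadraticTerm e p
  have hε : 0 < ε := half_pos hpos
  -- Near `p` the three coefficients exceed `ε`, `b - 1` and `d - 1`. Since `f ≥ 1`, one has `f² ≥
  -- f` and `1 / f² ≤ 1`, so `f ε ≥ |b| + |d| + 2` outweighs the lower-order terms.
  refine ⟨max 1 ((|b| + |d| + 2) / ε), by positivity, ?_⟩
  filter_upwards [he.isOpen.mem_nhds hp,
    (he.continuousAt_npbExpr hn hp).eventually (lt_mem_nhds (half_lt_self hpos)),
    hX.eventually (lt_mem_nhds (sub_one_lt b)),
    (he.continuousAt_inverseQuadraticTerm hn hp).eventually (lt_mem_nhds (sub_one_lt d))]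
    with x hxU h1 h2 h3 f hf
  have hf1 : 1 ≤ f := (le_max_left _ _).trans hf
  have hf2 : |b| + |d| + 2 ≤ f * ε := (div_le_iff₀ hε).1 ((le_max_right _ _).trans hf)
  rw [he.scalarCurvature_eq_npbExpr hn hinv hxU (by positivity)]
  have h4 : f * ε ≤ f ^ 2 * npbExpr e x := by
    have : f ≤ f ^ 2 := by nlinarith
    exact mul_le_mul this h1.le hε.le (by positivity)
  have h5 : -(|d| + 1) ≤ (1 / f ^ 2) * inverseQuadraticTerm e x := by
    have h6 : 1 / f ^ 2 ≤ 1 := by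
      rw [div_le_one (by positivity)]; nlinarith
    have h7 : 0 ≤ 1 / f ^ 2 := by positivity
    have h8 : -(|d| + 1) ≤ inverseQuadraticTerm e x := by linarith [neg_abs_le d]
    nlinarith [abs_nonneg d]
  linarith [neg_abs_le b]

end IsAdaptedFrame

/-- The scalar curvature does not refer to a frame, so thresholds obtained from different local
frames can be combined by taking a maximum over a finite cover. -/
theorem exists_scalarCurvature_pos (hn : r + s = n) (hinv : IsInvolutive Y) (hnpb : IsNPB r s Y)
    {K : Set M} (hK : IsCompact K) : ∃ f₀ : ℝ, 0 < f₀ ∧ ∀ f : ℝ, f₀ ≤ f →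
      ∀ x ∈ K, 0 < scalarCurvature (collapsedMetric Y f) x := by
  refine hK.induction_on (p := fun K => ∃ f₀ : ℝ, 0 < f₀ ∧ ∀ f : ℝ, f₀ ≤ f →
      ∀ x ∈ K, 0 < scalarCurvature (collapsedMetric Y f) x) ⟨1, one_pos, by simp⟩ ?_ ?_ ?_
  · rintro K K' hKK' ⟨f₀, h0, h⟩
    exact ⟨f₀, h0, fun f hf x hx => h f hf x (hKK' hx)⟩
  · rintro K K' ⟨f₀, h0, h⟩ ⟨f₁, h1, h'⟩
    refine ⟨max f₀ f₁, lt_max_of_lt_left h0, fun f hf x hx => ?_⟩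
    rcases hx with hx | hx
    · exact h f ((le_max_left _ _).trans hf) x hx
    · exact h' f ((le_max_right _ _).trans hf) x hx
  · intro p _
    obtain ⟨U, e, hp, he, hpos⟩ := hnpb p
    obtain ⟨f₀, h0, h⟩ := he.eventually_scalarCurvature_pos hn hinv hp (hpos p hp)
    exact ⟨_, mem_nhdsWithin_of_mem_nhds h, f₀, h0, fun f hf x hx => hx f hf⟩

end Positivity

end Collapse

end

theorem theorem4p7 {n r s : ℕ} (hn : r + s = n) {M : Type*} [TopologicalSpace M]
    [ChartedSpace (EuclideanSpace ℝ (Fin n)) M] [IsManifold (𝓡 n) ∞ M]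
    [RiemannianBundle (fun x : M => TangentSpace (𝓡 n) x)]
    [IsContMDiffRiemannianBundle (𝓡 n) ∞ (EuclideanSpace ℝ (Fin n))
      (fun x : M => TangentSpace (𝓡 n) x)]
    (Y : ∀ x : M, Submodule ℝ (TangentSpace (𝓡 n) x))
    (hY : Collapse.IsSubbundle s Y) (hinv : Collapse.IsInvolutive Y) :
    (∀ (U : Set M) (e : Fin r ⊕ Fin s → ∀ x : M, TangentSpace (𝓡 n) x),
      Collapse.IsAdaptedFrame Y U e → ∀ x ∈ U,
        Collapse.quarticTerm e x = 0 ∧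
        ∀ f : ℝ, 0 < f →
          Collapse.scalarCurvature (Collapse.collapsedMetric Y f) x =
            Collapse.scalarX e x + f ^ 2 * Collapse.scalarY e x
              + Collapse.quadraticTerm e x * f ^ 2 + Collapse.constantTerm e x
              + (1 / f ^ 2) * Collapse.inverseQuadraticTerm e x) ∧
    (Collapse.IsNPB r s Y →
      (∀ K : Set M, IsCompact K → ∃ f₀ : ℝ, 0 < f₀ ∧ ∀ f : ℝ, f₀ ≤ f →
        ∀ x ∈ K, 0 < Collapse.scalarCurvature (Collapse.collapsedMetric Y f) x) ∧
      (CompactSpace M → ∃ f₀ : ℝ, 0 < f₀ ∧ ∀ f : ℝ, f₀ ≤ f →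
        Collapse.IsPSCMetric (Collapse.collapsedMetric Y f))) := by
  refine ⟨fun U e he x hx => ⟨?_, fun f hf =>
    he.scalarCurvature_collapsedMetric hn hinv hx hf.ne'⟩, fun hnpb =>
    ⟨fun K hK => Collapse.exists_scalarCurvature_pos hn hinv hnpb hK, fun hM => ?_⟩⟩
  · simp [Collapse.quarticTerm, he.structureFn_inl_inr_inr hinv hx]
  · obtain ⟨f₀, h0, h⟩ := Collapse.exists_scalarCurvature_pos hn hinv hnpb hM.isCompact_univ
    refine ⟨f₀, h0, fun f hf => ⟨Collapse.exists_contMDiffRiemannianMetric hn (fun p => ?_)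
      (h0.trans_le hf).ne', fun x => h f hf x (Set.mem_univ x)⟩⟩
    -- The nearly positively bundle-like hypothesis already supplies an adapted frame around every
    -- point.
    obtain ⟨U, e, hp, he, _⟩ := hnpb p
    exact ⟨U, e, hp, he⟩
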